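/- Let $X$ be a connected, non-compact $C^\infty$ Riemannian manifold with Riemannian volume $\nu$, and let $M$ be a connected $C^\infty$ manifold on which a Lie group $G$ acts smoothly and transitively (manifolds are Hausdorff and second countable). Let $\lambda\neq 0$ be a Radon measure on $M$, quasiinvariant under $G$, such that the densities $\frac{d(g^*\lambda)}{d\lambda}(m)$ have a version $p^\lambda(g,m)\in[0,\infty)$ that is differentiable on $G\times M$. (Throughout, $f^*\mu$ denotes the image of the measure $\mu$ under $f$.) Let $\rho:X\to[0,\infty]$ and $p:X\times M\to[0,\infty]$ be measurable, with $\rho>0$ $\nu$-a.e., $\rho$ integrable over compact sets with respect to $\nu$, and, for $\nu$-a.e. $x$, $p(x,\cdot)>0$ $\lambda$-a.e. Put $q(x,m)=\rho(x)p(x,m)$ and $\tilde\sigma(dx,dm)=q(x,m)\,\nu(dx)\,\lambda(dm)$, and suppose that $\tilde\sigma(\Lambda\times M)<\infty$ for every Borel set $\Lambda\subset X$ with compact closure. Let $\Omega_X^M$ be the set of all $\omega\subset X\times M$ such that distinct elements of $\omega$ have distinct first components and the projection of $\omega$ to $X$ is locally finite. Equip it with the smallest $\sigma$-algebra for which all maps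 $\omega\mapsto\#(\omega\cap B)$ are measurable, where $B\subset X\times M$ is Borel and its projection to $X$ is Borel with compact closure. A marked Poisson measure with Lévy measure $\tilde\sigma$ is a probability measure $\pi$ on $\Omega_X^M$ such that, for every open $\Lambda\subset X$ with compact closure, the image of $\pi$ under $\omega\mapsto\omega\cap(\Lambda\times M)$ is $$e^{-\tilde\sigma(\Lambda\times M)}\sum_{n=0}^\infty\frac1{n!}\,\tilde\sigma_{\Lambda,n},$$ where $\tilde\sigma_{\Lambda,n}$ is the image of $(\tilde\sigma|_{\Lambda\times M})^{\otimes n}$, restricted to the $n$-tuples with pairwise distinct $x_i$, under $((x_1,m_1),\dots,(x_n,m_n))\mapsto\{(x_1,m_1),\dots,(x_n,m_n)\}$. Let $\mathfrak A$ be the group of all pairs $a=(\psi,\eta)$, where $\psi$ is a diffeomorphism of $X$ that is the identity outside a compact set and $\eta:X\to G$ is a $C^\infty$ map equal to the unit element outside a compact set, with multiplication $(\psi_1,\eta_1)(\psi_2,\eta_2)=(\psi_1\circ\psi_2,\ \eta_1\cdot(\eta_2\circ\psi_1^{-1}))$. It acts on $X\times M$ by $a(x,m)=(\psi(x),\eta(\psi(x))m)$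 and on $\Omega_X^M$ by $a(\omega)=\{a(x,m):(x,m)\in\omega\}$. For $a=(\psi,\eta)\in\mathfrak A$ put $$p_a^{\tilde\sigma}(x,m)=\frac{q(\psi^{-1}(x),\eta(x)^{-1}m)}{q(x,m)}\,p^\lambda(\eta(x),m)\,J^\psi_\nu(x)$$ if both values of $q$ lie in $(0,\infty)$, and $p_a^{\tilde\sigma}(x,m)=1$ otherwise. Here $J_\nu^\psi(x)$ is the factor by which the differential of $\psi^{-1}$ at $x$ changes Riemannian volumes, i.e. the Jacobian determinant normalised so that it is the density of $\psi^*\nu$ with respect to $\nu$. Then there is exactly one marked Poisson measure $\pi_{\tilde\sigma}$ with Lévy measure $\tilde\sigma$, and it is quasiinvariant under $\mathfrak A$: every $a\in\mathfrak A$ acts measurably on $\Omega_X^M$, and $a^*\pi_{\tilde\sigma}$ and $\pi_{\tilde\sigma}$ are mutually absolutely continuous. Moreover, for every $a\in\mathfrak A$, the function $p_a^{\tilde\sigma}$ is the density of $a^*\tilde\sigma$ with respect to $\tilde\sigma$; for every $\omega\in\Omega_X^M$ only finitely many $(x,m)\in\omega$ have $p_a^{\tilde\sigma}(x,m)\ne1$;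 and $$\frac{d(a^*\pi_{\tilde\sigma})}{d\pi_{\tilde\sigma}}(\omega)=\prod_{(x,m)\in\omega}p_a^{\tilde\sigma}(x,m)\qquad\text{for }\pi_{\tilde\sigma}\text{-a.e. }\omega .$$ -/

import Mathlib

open Set MeasureTheory Manifold Bundle
open scoped ContDiff ENNReal NNReal

noncomputable section

namespace MarkedPoisson

/-! ### Riemannian volume and Jacobian determinant -/

section Riemannian

variable {d : ℕ} {X : Type*} [TopologicalSpace X] [ChartedSpace (EuclideanSpace ℝ (Fin d)) X]
  [IsManifold (𝓡 d) ∞ X]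

variable (d X) in
/-- Smooth Riemannian metrics on a `d`-dimensional smooth manifold `X` without boundary. -/
abbrev RiemMetric : Type _ :=
  ContMDiffRiemannianMetric (𝓡 d) ∞ (EuclideanSpace ℝ (Fin d))
    (fun x : X => TangentSpace (𝓡 d) x)

/-- The `d`-dimensional volume `√ det (g_x(v_i, v_j))` of the parallelepiped spanned by tangent
vectors `v_1, …, v_d` at `x`. -/
def gramVolume (g : RiemMetric d X) (x : X) (v : Fin d → TangentSpace (𝓡 d) x) : ℝ :=
  Real.sqrt (Matrix.det (Matrix.of fun i j => g.inner x (v i) (v j)))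

/-- The `i`-th standard basis vector of the model space `ℝ^d`. -/
def stdVec (i : Fin d) : EuclideanSpace ℝ (Fin d) := EuclideanSpace.single i 1

/-- The function `√ det (g_ij)` in the local coordinates given by the chart `e`, with
`g_ij(y) = g(∂_i, ∂_j)` at the point with coordinates `y`. -/
def chartVolumeDensity (g : RiemMetric d X)
    (e : OpenPartialHomeomorph X (EuclideanSpace ℝ (Fin d))) (y : EuclideanSpace ℝ (Fin d)) :
    ℝ≥0∞ :=
  ENNReal.ofReal (gramVolume g (e.symm y) fun i =>
    mfderiv 𝓘(ℝ, EuclideanSpace ℝ (Fin d)) (𝓡 d) e.symm y (stdVec i))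

/-- The measure `√ det (g_ij) dy_1 ⋯ dy_d` of the chart `e`, as a measure on `X` carried by the
domain of `e`. -/
def chartVolume [MeasurableSpace X] (g : RiemMetric d X)
    (e : OpenPartialHomeomorph X (EuclideanSpace ℝ (Fin d))) : Measure X :=
  ((volume.restrict e.target).withDensity (chartVolumeDensity g e)).map e.symm

/-- The Riemannian volume: the least measure on `X` that dominates `√ det (g_ij) dy_1 ⋯ dy_d` in
every smooth chart. Since these local measures agree on overlaps of charts, this is the measure
whose restriction to the domain of each chart is the measure of that chart. -/
def riemVolume [MeasurableSpace X] (g : RiemMetric d X) : Measure X :=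
  ⨆ e ∈ IsManifold.maximalAtlas (𝓡 d) ∞ X, chartVolume g e

/-- The Jacobian determinant of a diffeomorphism `ψ` with respect to the Riemannian volume `ν`, in
the normalisation in which it is the density of the image of `ν` under `ψ` with respect to `ν`:
its value at `x` is the factor by which the differential of `ψ⁻¹` at `x` changes
`d`-dimensional volumes. -/
def jacobian (g : RiemMetric d X) (ψ : X ≃ₘ^∞⟮𝓡 d, 𝓡 d⟯ X) (x : X) : ℝ≥0∞ :=
  ENNReal.ofReal
    (gramVolume g (ψ.symm x) (fun i => mfderiv (𝓡 d) (𝓡 d) ψ.symm x (stdVec i)) /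
      gramVolume g x (fun i => (stdVec i : EuclideanSpace ℝ (Fin d))))

end Riemannian

/-! ### The marked configuration space -/

section Config

variable {X M : Type*} [TopologicalSpace X]

variable (X) in
/-- The configuration space `Γ_X` of all locally finite subsets of `X`. -/
def configurations : Set (Set X) := {γ | ∀ K : Set X, IsCompact K → (γ ∩ K).Finite}

variable (X M) in
/-- The marked configuration space: the sets `ξ ⊆ X × M` whose distinct elements have distinct
positions in `X`, and whose projection to `X` is a configuration. -/
def MarkedConfig : Type _ :=
  {ξ : Set (X × M) // InjOn Prod.fst ξ ∧ Prod.fst '' ξ ∈ configurations X}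

/-- The Borel subsets of `X × M` whose projection to `X` is a Borel set with compact closure. -/
def boundedSets [MeasurableSpace X] [MeasurableSpace M] : Set (Set (X × M)) :=
  {B | MeasurableSet B ∧ MeasurableSet (Prod.fst '' B) ∧ IsCompact (closure (Prod.fst '' B))}

/-- The counting function `N_B(ξ) = #(ξ ∩ B)`. -/
def count (B : Set (X × M)) (ξ : MarkedConfig X M) : ℕ := (ξ.1 ∩ B).ncard

/-- The smallest σ-algebra for which all `N_B`, `B` Borel with relatively compact projection, are
measurable. -/
instance [MeasurableSpace X] [MeasurableSpace M] : MeasurableSpace (MarkedConfig X M) :=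
  ⨆ B ∈ (boundedSets : Set (Set (X × M))), MeasurableSpace.comap (count B) ⊤

/-- The restriction map `p_Λ(ξ) = ξ ∩ (Λ × M)`. The space of marked configurations in `Λ` is
regarded as a subset of the space of all marked configurations. -/
def restrict (Λ : Set X) (ξ : MarkedConfig X M) : MarkedConfig X M :=
  ⟨ξ.1 ∩ Λ ×ˢ univ, ξ.2.1.mono inter_subset_left, fun K hK =>
    (ξ.2.2 K hK).subset (inter_subset_inter_left K (image_mono inter_subset_left))⟩

/-- The map `((x_1,m_1),…,(x_n,m_n)) ↦ {(x_1,m_1),…,(x_n,m_n)}` on the tuples with pairwise distinct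
`x_i` (the value on the other tuples is irrelevant, and set to be the empty configuration). -/
def ofTuple (n : ℕ) (z : Fin n → X × M) : MarkedConfig X M :=
  open Classical in
  if h : Function.Injective fun i => (z i).1 then
    ⟨range z, by
      rintro _ ⟨i, rfl⟩ _ ⟨j, rfl⟩ hij
      exact congrArg z (h hij), fun K _ =>
      ((finite_range z).image Prod.fst).subset inter_subset_left⟩
  else
    ⟨∅, by simp, fun K _ => by simp⟩

/-! ### The marked Poisson measure -/

variable [MeasurableSpace X] [MeasurableSpace M]

/-- The image on the `n`-point marked configurations in `Λ` of the `n`-th power of the restriction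
of `τ` to `Λ × M`, considered on the tuples with pairwise distinct positions. -/
def nPointMeasure (τ : Measure (X × M)) (Λ : Set X) (n : ℕ) : Measure (MarkedConfig X M) :=
  ((Measure.pi fun _ : Fin n => τ.restrict (Λ ×ˢ univ)).restrict
    {z | Function.Injective fun i => (z i).1}).map (ofTuple n)

/-- The marked Poisson measure in the window `Λ`:
`exp(-τ(Λ × M)) ∑_n (1/n!) τ_{Λ,n}`. -/
def localPoisson (τ : Measure (X × M)) (Λ : Set X) : Measure (MarkedConfig X M) :=
  ENNReal.ofReal (Real.exp (-(τ (Λ ×ˢ univ)).toReal)) •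
    Measure.sum fun n : ℕ => ((n.factorial : ℝ≥0∞)⁻¹) • nPointMeasure τ Λ n

/-- `P` is the marked Poisson measure with Lévy measure `τ`: the probability measure on the marked
configuration space whose image under `p_Λ`, for each open relatively compact `Λ ⊆ X`, is the
marked Poisson measure in `Λ`. -/
structure IsMarkedPoisson (τ : Measure (X × M)) (P : Measure (MarkedConfig X M)) : Prop where
  isProbabilityMeasure : IsProbabilityMeasure P
  map_restrict : ∀ Λ : Set X, IsOpen Λ → IsCompact (closure Λ) →
    P.map (restrict Λ) = localPoisson τ Λ

end Config

/-! ### The transformation group -/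

section Group

variable (d k : ℕ) (X G : Type*)
  [TopologicalSpace X] [ChartedSpace (EuclideanSpace ℝ (Fin d)) X]
  [TopologicalSpace G] [ChartedSpace (EuclideanSpace ℝ (Fin k)) G] [Group G]

/-- The underlying set of the semidirect product of the group of compactly supported diffeomorphisms
`ψ` of `X` and the group of smooth currents, i.e. the smooth maps `η : X → G` that are the identity
outside a compact set. -/
@[ext]
structure Transf where
  /-- the diffeomorphism -/
  ψ : X ≃ₘ^∞⟮𝓡 d, 𝓡 d⟯ X
  /-- the current -/
  η : C^∞⟮𝓡 d, X; 𝓡 k, G⟯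
  ψ_supp : ∃ K : Set X, IsCompact K ∧ ∀ x ∉ K, ψ x = x
  η_supp : ∃ K : Set X, IsCompact K ∧ ∀ x ∉ K, η x = 1

namespace Transf

variable {d k X G}

theorem symm_supp (a : Transf d k X G) :
    ∃ K : Set X, IsCompact K ∧ ∀ x ∉ K, a.ψ.symm x = x := by
  obtain ⟨K, hK, h⟩ := a.ψ_supp
  refine ⟨K, hK, fun x hx => ?_⟩
  rw [← h x hx, a.ψ.symm_apply_apply, h x hx]

variable [LieGroup (𝓡 k) ∞ G]

/-- `(ψ₁, η₁)(ψ₂, η₂) = (ψ₁ ∘ ψ₂, η₁ · (η₂ ∘ ψ₁⁻¹))`. -/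
instance : Mul (Transf d k X G) where
  mul a b :=
    { ψ := b.ψ.trans a.ψ
      η := a.η * b.η.comp ⟨a.ψ.symm, a.ψ.symm.contMDiff⟩
      ψ_supp := by
        obtain ⟨K, hK, h⟩ := a.ψ_supp
        obtain ⟨L, hL, h'⟩ := b.ψ_supp
        refine ⟨K ∪ L, hK.union hL, fun x hx => ?_⟩
        simp only [mem_union, not_or] at hx
        simp [h x hx.1, h' x hx.2]
      η_supp := by
        obtain ⟨K, hK, h⟩ := a.η_supp
        obtain ⟨L, hL, h'⟩ := b.η_supp
        obtain ⟨N, hN, h''⟩ := a.symm_supp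
        refine ⟨K ∪ L ∪ N, (hK.union hL).union hN, fun x hx => ?_⟩
        simp only [mem_union, not_or] at hx
        change a.η x * b.η (a.ψ.symm x) = 1
        rw [h x hx.1.1, h'' x hx.2, h' x hx.1.2, one_mul] }

instance : One (Transf d k X G) where
  one :=
    { ψ := Diffeomorph.refl (𝓡 d) X ∞
      η := 1
      ψ_supp := ⟨∅, isCompact_empty, fun _ _ => rfl⟩
      η_supp := ⟨∅, isCompact_empty, fun _ _ => rfl⟩ }

/-- `(ψ, η)⁻¹ = (ψ⁻¹, η⁻¹ ∘ ψ)`. -/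
instance : Inv (Transf d k X G) where
  inv a :=
    { ψ := a.ψ.symm
      η := (a.η⁻¹).comp ⟨a.ψ, a.ψ.contMDiff⟩
      ψ_supp := a.symm_supp
      η_supp := by
        obtain ⟨K, hK, h⟩ := a.η_supp
        obtain ⟨N, hN, h'⟩ := a.ψ_supp
        refine ⟨K ∪ N, hK.union hN, fun x hx => ?_⟩
        simp only [mem_union, not_or] at hx
        change (a.η (a.ψ x))⁻¹ = 1
        rw [h' x hx.2, h x hx.1, inv_one] }

theorem mul_ψ (a b : Transf d k X G) (x : X) : (a * b).ψ x = a.ψ (b.ψ x) := rfl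
theorem mul_η (a b : Transf d k X G) (x : X) : (a * b).η x = a.η x * b.η (a.ψ.symm x) := rfl
theorem one_ψ (x : X) : (1 : Transf d k X G).ψ x = x := rfl
theorem one_η (x : X) : (1 : Transf d k X G).η x = 1 := rfl
theorem inv_ψ (a : Transf d k X G) (x : X) : (a⁻¹).ψ x = a.ψ.symm x := rfl
theorem inv_η (a : Transf d k X G) (x : X) : (a⁻¹).η x = (a.η (a.ψ x))⁻¹ := rfl

instance : Group (Transf d k X G) where
  mul_assoc a b c := by
    ext x
    · rfl
    · simp only [mul_η, mul_assoc]
      rfl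
  one_mul a := by
    ext x
    · rfl
    · simp only [mul_η, one_η, one_mul]
      rfl
  mul_one a := by
    ext x
    · rfl
    · simp only [mul_η, one_η, mul_one]
  inv_mul_cancel a := by
    ext x
    · simp [mul_ψ, inv_ψ, one_ψ]
    · simp only [mul_η, one_η, inv_η]
      exact inv_mul_cancel _

variable {M : Type*} [MulAction G M]

/-- The action `(ψ, η)(x, m) = (ψ(x), η(ψ(x)) m)` on `X × M`. -/
instance : MulAction (Transf d k X G) (X × M) where
  smul a z := (a.ψ z.1, a.η (a.ψ z.1) • z.2)
  one_smul z := Prod.ext rfl (one_smul G z.2)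
  mul_smul a b z := by
    refine Prod.ext rfl ?_
    change (a * b).η (a.ψ (b.ψ z.1)) • z.2 = a.η (a.ψ (b.ψ z.1)) • b.η (b.ψ z.1) • z.2
    rw [mul_η, a.ψ.symm_apply_apply, mul_smul]

theorem smul_def (a : Transf d k X G) (z : X × M) :
    a • z = (a.ψ z.1, a.η (a.ψ z.1) • z.2) := rfl

/-- The lifted action `a(ξ) = {a(x, m) | (x, m) ∈ ξ}` on marked configurations. -/
def lift (a : Transf d k X G) (ξ : MarkedConfig X M) : MarkedConfig X M :=
  ⟨(fun z => a • z) '' ξ.1, by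
    rintro _ ⟨z, hz, rfl⟩ _ ⟨w, hw, rfl⟩ h
    rw [ξ.2.1 hz hw (a.ψ.injective h)], fun K hK => by
    refine ((ξ.2.2 _ (hK.image a.ψ.symm.continuous)).image a.ψ).subset ?_
    rintro _ ⟨⟨_, ⟨z, hz, rfl⟩, rfl⟩, hxK⟩
    exact ⟨z.1, ⟨⟨z, hz, rfl⟩, ⟨_, hxK, a.ψ.symm_apply_apply z.1⟩⟩, rfl⟩⟩

/-- The lifted action is a group action on the marked configuration space. -/
instance : MulAction (Transf d k X G) (MarkedConfig X M) where
  smul a ξ := a.lift ξ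
  one_smul ξ := Subtype.ext <| by
    change (fun z => (1 : Transf d k X G) • z) '' ξ.1 = ξ.1
    simp
  mul_smul a b ξ := Subtype.ext <| by
    change (fun z => (a * b) • z) '' ξ.1 = (fun z => a • z) '' ((fun z => b • z) '' ξ.1)
    simp [image_image, mul_smul]

end Transf

end Group

/-! ### Quasiinvariance and densities -/

/-- `μ` is quasiinvariant under the action of the group `A`: for each `a ∈ A` the transformation
`a` is measurable, and the image of `μ` under it is equivalent to `μ`. -/
def QuasiInvariant (A : Type*) {Y : Type*} [Group A] [MulAction A Y] [MeasurableSpace Y]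
    (μ : Measure Y) : Prop :=
  ∀ a : A, Measurable (fun y : Y => a • y) ∧
    μ.map (fun y => a • y) ≪ μ ∧ μ ≪ μ.map (fun y => a • y)

section Densities

variable {d k : ℕ} {X G M : Type*}
  [TopologicalSpace X] [ChartedSpace (EuclideanSpace ℝ (Fin d)) X] [IsManifold (𝓡 d) ∞ X]
  [TopologicalSpace G] [ChartedSpace (EuclideanSpace ℝ (Fin k)) G] [Group G]
  [MulAction G M]

/-- The measure `ρ(x) p(x, m) ν(dx) λ(dm)` on `X × M`, with `ν` the Riemannian volume. -/
def levyMeasure [MeasurableSpace X] [MeasurableSpace M] (g : RiemMetric d X) (lam : Measure M)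
    (ρ : X → ℝ≥0∞) (p : X → M → ℝ≥0∞) : Measure (X × M) :=
  ((riemVolume g).prod lam).withDensity fun z => ρ z.1 * p z.1 z.2

/-- The one-point density: for `a = (ψ, η)` and `q(x, m) = ρ(x) p(x, m)`,
`q(ψ⁻¹(x), η(x)⁻¹ m) / q(x, m) * p^λ(η(x), m) * J^ψ(x)` at the points where both values of `q` are
positive and finite, and `1` at the other points. -/
def onePointDensity (g : RiemMetric d X) (plam : G → M → ℝ≥0)
    (ρ : X → ℝ≥0∞) (p : X → M → ℝ≥0∞) (a : Transf d k X G) (z : X × M) : ℝ≥0∞ :=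
  open Classical in
  let q : X × M → ℝ≥0∞ := fun w => ρ w.1 * p w.1 w.2
  let z' : X × M := (a.ψ.symm z.1, (a.η z.1)⁻¹ • z.2)
  if (0 < q z ∧ q z < ⊤) ∧ (0 < q z' ∧ q z' < ⊤) then
    q z' / q z * plam (a.η z.1) z.2 * jacobian g a.ψ z.1
  else 1

end Densities

end MarkedPoisson

end

noncomputable section

namespace MarkedPoisson

/-! ### Gram determinants under linear maps and smooth maps -/

section RiemannianVolume

variable {d : ℕ} {X : Type*} [TopologicalSpace X] [ChartedSpace (EuclideanSpace ℝ (Fin d)) X]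
  [IsManifold (𝓡 d) ∞ X]

/-! Everything on the configuration space is reduced to void probabilities. Positions in a
configuration are distinct, so the number of points in `B` is the limit of the number of occupied
cells when `B` is cut along finer and finer partitions of `X`. Hence the events "no point in `B`"
generate the σ-algebra (`generateFrom_voidEvents`). They are stable under intersection, so they
determine a finite measure (`ext_of_void`). For a marked Poisson measure they have probability `exp
(-τ B)`, which gives uniqueness. For existence, independent Poisson configurations on the layers of
a compact exhaustion are glued, and exponentials of sums factor (`exists_hasPoissonVoids`).
Coinciding positions are negligible because `X`, being connected and non-compact, has positive
dimension, so `τ` does not charge fibres over points.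

The density formula rests on the exponential identity `∫ ∏ u = exp (∫ u dτ - τ (Λ × M))`
(`lintegral_localPoisson`). Let `u` be the density of `a^* τ` and equal to `1` off a compact set of
positions. Replacing `u` by `0` on `B` inserts the void event of `B` into the product, so that event
has mass `exp (τ (Λ × M \ a⁻¹ B) - τ (Λ × M)) = exp (-τ (a⁻¹ B))` under the tilted measure. This is
also its mass under `a^* P` (`IsMarkedPoisson.map_eq_withDensity`).

Two facts about `u` remain. It is the density of `a^* τ`: this is Fubini, the change of variables
for Riemannian volume (`map_riemVolume`), the density of the mark measure, and cancellation of `q`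
(`map_smul_levyMeasure`). It equals `1` off a compact set at every point, not just almost
everywhere: transitivity and quasiinvariance give `λ` full support, so the continuous function
`p^λ(1, ·)`, almost everywhere `1`, is identically `1`. -/

theorem det_gram_map (B : EuclideanSpace ℝ (Fin d) →L[ℝ] EuclideanSpace ℝ (Fin d) →L[ℝ] ℝ)
    (T : EuclideanSpace ℝ (Fin d) →L[ℝ] EuclideanSpace ℝ (Fin d)) :
    (Matrix.of fun i j => B (T (stdVec i)) (T (stdVec j))).det =
      T.det ^ 2 * (Matrix.of fun i j => B (stdVec i) (stdVec j)).det := by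
  let b := EuclideanSpace.basisFun (Fin d) ℝ
  have hb : ∀ i, b i = stdVec i := fun i => by simp [b, stdVec]
  set A := LinearMap.toMatrix b.toBasis b.toBasis T.toLinearMap with hA
  have h1 : (Matrix.of fun i j => B (T (stdVec i)) (T (stdVec j))) =
      A.transpose * (Matrix.of fun i j => B (stdVec i) (stdVec j)) * A := by
    ext i j
    have hT : ∀ i, T (stdVec i) = ∑ k, A k i • stdVec k := by
      intro i
      have := b.toBasis.sum_repr (T (stdVec i))
      rw [← this]
      refine Finset.sum_congr rfl fun k _ => ?_
      simp [hA, LinearMap.toMatrix_apply, hb]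
    rw [Matrix.of_apply, hT i, hT j]
    simp only [map_sum, map_smul, sum_apply, smul_apply,
      smul_eq_mul, Matrix.mul_apply, Matrix.transpose_apply, Matrix.of_apply, Finset.mul_sum,
      Finset.sum_mul]
    refine Finset.sum_congr rfl fun k _ => Finset.sum_congr rfl fun m _ => ?_
    ring
  have hdet : T.det = A.det := by
    rw [hA, LinearMap.det_toMatrix]
  rw [h1, Matrix.det_mul, Matrix.det_mul, Matrix.det_transpose, hdet]
  ring

theorem det_gram_pos (B : EuclideanSpace ℝ (Fin d) →L[ℝ] EuclideanSpace ℝ (Fin d) →L[ℝ] ℝ)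
    (hsymm : ∀ v w, B v w = B w v) (hpos : ∀ v, v ≠ 0 → 0 < B v v) :
    0 < (Matrix.of fun i j => B (stdVec i) (stdVec j)).det := by
  refine Matrix.PosDef.det_pos ?_
  rw [Matrix.posDef_iff_dotProduct_mulVec]
  refine ⟨?_, fun v hv => ?_⟩
  · ext i j
    simp [hsymm (stdVec j)]
  · have key : star v ⬝ᵥ (Matrix.of fun i j => B (stdVec i) (stdVec j)).mulVec v =
        B (WithLp.toLp 2 v) (WithLp.toLp 2 v) := by
      have hv : (WithLp.toLp 2 v : EuclideanSpace ℝ (Fin d)) = ∑ k, v k • stdVec k := by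
        ext i
        simp [stdVec, Pi.single_apply]
      rw [hv]
      simp only [map_sum, map_smul, sum_apply, smul_apply,
        smul_eq_mul, dotProduct, Matrix.mulVec, Matrix.of_apply, Finset.mul_sum]
      rw [Finset.sum_comm]
      refine Finset.sum_congr rfl fun k _ => Finset.sum_congr rfl fun m _ => ?_
      simp only [star_trivial]
      ring
    rw [key]
    refine hpos _ fun h => hv ?_
    have := congrArg WithLp.ofLp h
    simpa using this

/-- Every tangent space is definitionally the model space, via the preferred chart at the point. So
`stdVec` is a basis of each of them, and endomorphisms have determinants. -/
theorem gramVolume_map (g : RiemMetric d X) (x : X)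
    (T : EuclideanSpace ℝ (Fin d) →L[ℝ] EuclideanSpace ℝ (Fin d)) :
    gramVolume g x (fun i => (T (stdVec i) : EuclideanSpace ℝ (Fin d))) =
      |T.det| * gramVolume g x (fun i => (stdVec i : EuclideanSpace ℝ (Fin d))) := by
  have h := det_gram_map (g.inner x) T
  unfold gramVolume
  rw [← Real.sqrt_sq_eq_abs, ← Real.sqrt_mul (sq_nonneg _)]
  exact congrArg Real.sqrt h

theorem gramVolume_stdVec_pos (g : RiemMetric d X) (x : X) :
    0 < gramVolume g x (fun i => (stdVec i : EuclideanSpace ℝ (Fin d))) :=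
  Real.sqrt_pos.2 (det_gram_pos (g.inner x) (g.symm x) (g.pos x))

/-- The Gram volume of `stdVec` at a moving point may jump with the preferred chart. Images of fixed
vectors under the differential of a smooth map form continuous sections of the tangent bundle, so
their Gram volume does not. -/
theorem continuousOn_gramVolume_mfderiv (g : RiemMetric d X)
    {f : EuclideanSpace ℝ (Fin d) → X} {U : Set (EuclideanSpace ℝ (Fin d))} (hU : IsOpen U)
    (hf : ContMDiffOn 𝓘(ℝ, EuclideanSpace ℝ (Fin d)) (𝓡 d) ∞ f U) :
    ContinuousOn (fun y => gramVolume g (f y) fun i =>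
      mfderiv 𝓘(ℝ, EuclideanSpace ℝ (Fin d)) (𝓡 d) f y (stdVec i)) U := by
  have hvec : ∀ v : EuclideanSpace ℝ (Fin d), ContMDiffOn 𝓘(ℝ, EuclideanSpace ℝ (Fin d))
      ((𝓡 d).prod 𝓘(ℝ, EuclideanSpace ℝ (Fin d))) 0
      (fun y => (TotalSpace.mk' (EuclideanSpace ℝ (Fin d)) (f y)
        (mfderiv 𝓘(ℝ, EuclideanSpace ℝ (Fin d)) (𝓡 d) f y v) :
        TangentBundle (𝓡 d) X)) U := by
    intro v
    have h1 := hf.contMDiffOn_tangentMapWithin (m := 0) (by simp) hU.uniqueMDiffOn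
    have h2 : ContMDiff 𝓘(ℝ, EuclideanSpace ℝ (Fin d))
        𝓘(ℝ, EuclideanSpace ℝ (Fin d)).tangent 0
        (fun y => (⟨y, v⟩ : TangentBundle 𝓘(ℝ, EuclideanSpace ℝ (Fin d))
          (EuclideanSpace ℝ (Fin d)))) := by
      exact contMDiff_vectorSpace_iff_contDiff.2 (contDiff_const (c := v))
    refine (h1.comp h2.contMDiffOn fun y hy => hy).congr fun y hy => ?_
    simp only [Function.comp, tangentMapWithin]
    rw [mfderivWithin_of_isOpen hU hy]
  have hg : ∀ v w : EuclideanSpace ℝ (Fin d), ContinuousOn (fun y =>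
      g.inner (f y) (mfderiv 𝓘(ℝ, EuclideanSpace ℝ (Fin d)) (𝓡 d) f y v)
        (mfderiv 𝓘(ℝ, EuclideanSpace ℝ (Fin d)) (𝓡 d) f y w)) U := by
    intro v w y hy
    have h3 : ContMDiffWithinAt 𝓘(ℝ, EuclideanSpace ℝ (Fin d)) ((𝓡 d).prod 𝓘(ℝ)) 0
        (fun m ↦ TotalSpace.mk' ℝ (E := Bundle.Trivial X ℝ) (f m) (g.inner (f m)
          (mfderiv 𝓘(ℝ, EuclideanSpace ℝ (Fin d)) (𝓡 d) f m v)
          (mfderiv 𝓘(ℝ, EuclideanSpace ℝ (Fin d)) (𝓡 d) f m w))) U y := by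
      apply ContMDiffWithinAt.clm_bundle_apply₂ (F₁ := EuclideanSpace ℝ (Fin d))
        (F₂ := EuclideanSpace ℝ (Fin d))
      · exact ContMDiffAt.comp_contMDiffWithinAt y
          ((g.contMDiff.of_le (by simp)).contMDiffAt) ((hf.of_le (by simp)) y hy)
      · exact hvec v y hy
      · exact hvec w y hy
    simp only [contMDiffWithinAt_totalSpace] at h3
    exact h3.2.continuousWithinAt
  unfold gramVolume
  refine Real.continuous_sqrt.comp_continuousOn ?_
  refine (continuous_id.matrix_det).comp_continuousOn
    (f := fun y => Matrix.of fun i j => g.inner (f y)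
      (mfderiv 𝓘(ℝ, EuclideanSpace ℝ (Fin d)) (𝓡 d) f y (stdVec i))
      (mfderiv 𝓘(ℝ, EuclideanSpace ℝ (Fin d)) (𝓡 d) f y (stdVec j))) ?_
  exact continuousOn_pi.2 fun i => continuousOn_pi.2 fun j => hg _ _

end RiemannianVolume

theorem _root_.ContinuousOn.measurableSet_inter_preimage {α β : Type*} [TopologicalSpace α]
    [MeasurableSpace α] [OpensMeasurableSpace α] [TopologicalSpace β] [MeasurableSpace β]
    [BorelSpace β] {f : α → β} {s : Set α} {t : Set β} (hf : ContinuousOn f s)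
    (hs : MeasurableSet s) (ht : MeasurableSet t) : MeasurableSet (s ∩ f ⁻¹' t) := by
  have h := (continuousOn_iff_continuous_domRestrict.1 hf).measurable ht
  have h2 := hs.subtype_image h
  convert h2 using 1
  ext x
  simp [and_comm]

theorem exists_countable_charts {d : ℕ} {X : Type*} [TopologicalSpace X]
    [ChartedSpace (EuclideanSpace ℝ (Fin d)) X] [SecondCountableTopology X] :
    ∃ s : Set X, s.Countable ∧
    ⋃ x ∈ s, (chartAt (EuclideanSpace ℝ (Fin d)) x).source = univ :=
  TopologicalSpace.countable_cover_nhds fun x =>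
    (chartAt (EuclideanSpace ℝ (Fin d)) x).open_source.mem_nhds (mem_chart_source _ x)

theorem aemeasurable_symm_withDensity {d : ℕ} {X : Type*} [TopologicalSpace X]
    [MeasurableSpace X] [BorelSpace X]
    (e : OpenPartialHomeomorph X (EuclideanSpace ℝ (Fin d)))
    (f : EuclideanSpace ℝ (Fin d) → ℝ≥0∞) :
    AEMeasurable e.symm ((volume.restrict e.target).withDensity f) :=
  (e.continuousOn_symm.aemeasurable e.open_target.measurableSet).mono_ac
    (withDensity_absolutelyContinuous _ _)

/-! ### Riemannian volume as a measure -/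

section RiemannianVolume

variable {d : ℕ} {X : Type*} [TopologicalSpace X] [ChartedSpace (EuclideanSpace ℝ (Fin d)) X]
  [IsManifold (𝓡 d) ∞ X]

theorem gramVolume_mfderiv_comp (g : RiemMetric d X) {N P : Type*}
    [TopologicalSpace N] [ChartedSpace (EuclideanSpace ℝ (Fin d)) N]
    [TopologicalSpace P] [ChartedSpace (EuclideanSpace ℝ (Fin d)) P]
    {h : P → X} {κ : N → P} {y : N}
    (hκ : MDifferentiableAt (𝓡 d) (𝓡 d) κ y) (hh : MDifferentiableAt (𝓡 d) (𝓡 d) h (κ y)) :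
    gramVolume g (h (κ y)) (fun i => mfderiv (𝓡 d) (𝓡 d) (h ∘ κ) y (stdVec i)) =
      |ContinuousLinearMap.det (M := EuclideanSpace ℝ (Fin d)) (mfderiv (𝓡 d) (𝓡 d) κ y)| *
        gramVolume g (h (κ y)) (fun i => mfderiv (𝓡 d) (𝓡 d) h (κ y) (stdVec i)) := by
  rw [mfderiv_comp y hh hκ]
  let S : EuclideanSpace ℝ (Fin d) →L[ℝ] EuclideanSpace ℝ (Fin d) := mfderiv (𝓡 d) (𝓡 d) κ y
  let T : EuclideanSpace ℝ (Fin d) →L[ℝ] EuclideanSpace ℝ (Fin d) := mfderiv (𝓡 d) (𝓡 d) h (κ y)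
  have h1 := gramVolume_map g (h (κ y)) (T.comp S)
  have h2 := gramVolume_map g (h (κ y)) T
  have h3 : (T.comp S).det = T.det * S.det := by
    simp [ContinuousLinearMap.det, LinearMap.det_comp]
  refine h1.trans ?_
  rw [h3, abs_mul, mul_comm |T.det|, mul_assoc, ← h2]
  rfl

/-- The volume distortion of a smooth map, computed with respect to the preferred charts. -/
theorem gramVolume_mfderiv_comp' (g : RiemMetric d X) {N : Type*}
    [TopologicalSpace N] [ChartedSpace (EuclideanSpace ℝ (Fin d)) N]
    {h : X → X} {κ : N → X} {y : N}
    (hκ : MDifferentiableAt (𝓡 d) (𝓡 d) κ y) (hh : MDifferentiableAt (𝓡 d) (𝓡 d) h (κ y)) :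
    gramVolume g (h (κ y)) (fun i => mfderiv (𝓡 d) (𝓡 d) (h ∘ κ) y (stdVec i)) =
      gramVolume g (h (κ y)) (fun i => mfderiv (𝓡 d) (𝓡 d) h (κ y) (stdVec i)) /
        gramVolume g (κ y) (fun i => (stdVec i : EuclideanSpace ℝ (Fin d))) *
      gramVolume g (κ y) (fun i => mfderiv (𝓡 d) (𝓡 d) κ y (stdVec i)) := by
  have h1 := gramVolume_map g (κ y) (mfderiv (𝓡 d) (𝓡 d) κ y)
  have h2 := (gramVolume_stdVec_pos g (κ y)).ne'
  rw [gramVolume_mfderiv_comp g hκ hh]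
  refine Eq.trans ?_ (congrArg (_ * ·) h1.symm)
  have aux : ∀ a b c : ℝ, c ≠ 0 → a * b = b / c * (a * c) := fun a b c hc => by field_simp
  exact aux _ _ _ h2

theorem continuousOn_chartVolumeDensity (g : RiemMetric d X)
    {e : OpenPartialHomeomorph X (EuclideanSpace ℝ (Fin d))}
    (he : e ∈ IsManifold.maximalAtlas (𝓡 d) ∞ X) :
    ContinuousOn (chartVolumeDensity g e) e.target :=
  ENNReal.continuous_ofReal.comp_continuousOn
    (continuousOn_gramVolume_mfderiv g e.open_target (contMDiffOn_symm_of_mem_maximalAtlas he))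

variable [MeasurableSpace X] [BorelSpace X]

theorem chartVolume_apply (g : RiemMetric d X)
    (e : OpenPartialHomeomorph X (EuclideanSpace ℝ (Fin d))) {A : Set X} (hA : MeasurableSet A) :
    chartVolume g e A = ∫⁻ y in e.target ∩ e.symm ⁻¹' A, chartVolumeDensity g e y := by
  rw [chartVolume, Measure.map_apply_of_aemeasurable (aemeasurable_symm_withDensity e _) hA,
    withDensity_apply', Measure.restrict_restrict' e.open_target.measurableSet, inter_comm]

theorem chartVolume_compl_source (g : RiemMetric d X)
    (e : OpenPartialHomeomorph X (EuclideanSpace ℝ (Fin d))) :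
    chartVolume g e e.sourceᶜ = 0 := by
  rw [chartVolume_apply g e e.open_source.measurableSet.compl]
  have : e.target ∩ e.symm ⁻¹' e.sourceᶜ = ∅ := by
    ext y
    simp only [mem_inter_iff, mem_preimage, mem_compl_iff, mem_empty_iff_false, iff_false, not_and,
      not_not]
    exact fun hy => e.map_target hy
  rw [this, Measure.restrict_empty, lintegral_zero_measure]

/-- Change of variables along the transition map: by the chain rule, its Jacobian is the ratio of
the two chart densities. -/
theorem chartVolume_eq_of_subset (g : RiemMetric d X)
    {e e' : OpenPartialHomeomorph X (EuclideanSpace ℝ (Fin d))}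
    (he : e ∈ IsManifold.maximalAtlas (𝓡 d) ∞ X) (he' : e' ∈ IsManifold.maximalAtlas (𝓡 d) ∞ X)
    {A : Set X} (hA : MeasurableSet A) (h : A ⊆ e.source) (h' : A ⊆ e'.source) :
    chartVolume g e A = chartVolume g e' A := by
  rw [chartVolume_apply g e hA, chartVolume_apply g e' hA]
  set S := e.target ∩ e.symm ⁻¹' A with hSdef
  have hS : MeasurableSet S :=
    e.continuousOn_symm.measurableSet_inter_preimage e.open_target.measurableSet hA
  have himg : (e' ∘ e.symm) '' S = e'.target ∩ e'.symm ⁻¹' A := by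
    ext y
    constructor
    · rintro ⟨z, ⟨hz, hzA⟩, rfl⟩
      refine ⟨e'.map_source (h' hzA), ?_⟩
      simpa [e'.left_inv (h' hzA)] using hzA
    · rintro ⟨hy, hyA⟩
      refine ⟨e (e'.symm y), ⟨e.map_source (h hyA), ?_⟩, ?_⟩
      · simpa [e.left_inv (h hyA)] using hyA
      · simp [e.left_inv (h hyA), e'.right_inv hy]
  have hdiff : ∀ y ∈ S, MDifferentiableAt (𝓡 d) (𝓡 d) (e' ∘ e.symm) y := fun y hy =>
    ((contMDiffAt_of_mem_maximalAtlas he' (h' hy.2)).comp y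
      (contMDiffAt_symm_of_mem_maximalAtlas he hy.1)).mdifferentiableAt (by simp)
  rw [← himg, lintegral_image_eq_lintegral_abs_det_fderiv_mul volume hS
    (f' := fun y => fderiv ℝ (e' ∘ e.symm) y)]
  · refine setLIntegral_congr_fun hS fun y hy => ?_
    have hd := hdiff y hy
    have hval : e'.symm ((e' ∘ e.symm) y) = e.symm y := e'.left_inv (h' hy.2)
    have hsymm : MDifferentiableAt (𝓡 d) (𝓡 d) e'.symm ((e' ∘ e.symm) y) :=
      (contMDiffAt_symm_of_mem_maximalAtlas he'
        (e'.map_source (h' hy.2))).mdifferentiableAt (by simp)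
    have hev : e.symm =ᶠ[nhds y] e'.symm ∘ (e' ∘ e.symm) := by
      have : e.target ∩ e.symm ⁻¹' e'.source ∈ nhds y :=
        (e.isOpen_inter_preimage_symm e'.open_source).mem_nhds ⟨hy.1, h' hy.2⟩
      filter_upwards [this] with z hz
      exact (e'.left_inv hz.2).symm
    have key := gramVolume_mfderiv_comp g hd hsymm
    rw [hval, ← hev.mfderiv_eq] at key
    simp only [chartVolumeDensity]
    rw [hval, ← ENNReal.ofReal_mul (abs_nonneg _), ← mfderiv_eq_fderiv]
    exact congrArg ENNReal.ofReal key
  · intro y hy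
    exact (mdifferentiableAt_iff_differentiableAt.1 (hdiff y hy)).hasFDerivAt.hasFDerivWithinAt
  · intro y hy z hz hyz
    exact e.symm.injOn hy.1 hz.1 (e'.injOn (h' hy.2) (h' hz.2) hyz)

/-- A supremum of measures is not computed set by set, so the upper bound needs one measure that
dominates every chart volume and agrees with that of `e` inside its domain. -/
theorem riemVolume_apply_of_subset (g : RiemMetric d X)
    {e : OpenPartialHomeomorph X (EuclideanSpace ℝ (Fin d))}
    (he : e ∈ IsManifold.maximalAtlas (𝓡 d) ∞ X)
    {A : Set X} (hA : MeasurableSet A) (h : A ⊆ e.source) :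
    riemVolume g A = chartVolume g e A := by
  refine le_antisymm ?_ (Measure.le_iff'.1 (le_iSup₂_of_le e he le_rfl) A)
  have hs := e.open_source.measurableSet
  -- Infinite mass at each point outside the chart makes domination trivial for sets leaving
  -- `e.source`.
  let μ : Measure X := chartVolume g e + (⊤ : ℝ≥0∞) • (Measure.count.restrict e.sourceᶜ)
  have hμ : riemVolume g ≤ μ := by
    refine iSup₂_le fun e' he' => Measure.le_iff.2 fun B hB => ?_
    by_cases hne : (B ∩ e.sourceᶜ).Nonempty
    · have : μ B = ⊤ := by
        simp only [μ, Measure.add_apply, Measure.smul_apply, smul_eq_mul,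
          Measure.restrict_apply hB, ENNReal.add_eq_top]
        refine Or.inr (ENNReal.top_mul fun h0 => ?_)
        exact hne.ne_empty (Measure.count_eq_zero_iff.1 h0)
      simp [this]
    · have hBe : B ⊆ e.source := fun x hx => by_contra fun hxe => hne ⟨x, hx, hxe⟩
      have h1 : chartVolume g e' B = chartVolume g e' (B ∩ e'.source) := by
        rw [← measure_inter_add_sdiff B e'.open_source.measurableSet]
        simp [measure_mono_null (sdiff_subset_compl B e'.source) (chartVolume_compl_source g e')]
      rw [h1, ← chartVolume_eq_of_subset g he he' (hB.inter e'.open_source.measurableSet)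
        (inter_subset_left.trans hBe) inter_subset_right]
      exact (measure_mono inter_subset_left).trans (by simp [μ])
  refine (Measure.le_iff'.1 hμ A).trans_eq ?_
  have : A ∩ e.sourceᶜ = ∅ := by
    rw [← disjoint_iff_inter_eq_empty]
    exact disjoint_compl_right_iff_subset.2 h
  simp [μ, Measure.restrict_apply hA, this]

theorem riemVolume_restrict_source (g : RiemMetric d X)
    {e : OpenPartialHomeomorph X (EuclideanSpace ℝ (Fin d))}
    (he : e ∈ IsManifold.maximalAtlas (𝓡 d) ∞ X) :
    (riemVolume g).restrict e.source = (chartVolume g e).restrict e.source := by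
  ext A hA
  rw [Measure.restrict_apply hA, Measure.restrict_apply hA,
    riemVolume_apply_of_subset g he (hA.inter e.open_source.measurableSet) inter_subset_right]

instance sFinite_chartVolume (g : RiemMetric d X)
    (e : OpenPartialHomeomorph X (EuclideanSpace ℝ (Fin d))) : SFinite (chartVolume g e) := by
  unfold chartVolume; infer_instance

instance sFinite_riemVolume [SecondCountableTopology X] (g : RiemMetric d X) :
    SFinite (riemVolume g) := by
  obtain ⟨s, hs, hcov⟩ := exists_countable_charts (d := d) (X := X)
  rcases s.eq_empty_or_nonempty with rfl | hne
  · have : IsEmpty X := by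
      rw [← univ_eq_empty_iff, ← hcov]; simp
    rw [Measure.eq_zero_of_isEmpty (riemVolume g)]
    infer_instance
  obtain ⟨f, rfl⟩ := hs.exists_eq_range hne
  let U : ℕ → Set X := fun n => (chartAt (EuclideanSpace ℝ (Fin d)) (f n)).source
  have hU : ∀ n, MeasurableSet (U n) := fun n => (chartAt _ (f n)).open_source.measurableSet
  have hcov' : ⋃ n, disjointed U n = univ := by
    rw [iUnion_disjointed, ← hcov]; simp [U]
  rw [← Measure.restrict_univ (μ := riemVolume g), ← hcov',
    Measure.restrict_iUnion (disjoint_disjointed U) (fun n => MeasurableSet.disjointed hU n)]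
  have (n : ℕ) : SFinite ((riemVolume g).restrict (disjointed U n)) := by
    rw [← Measure.restrict_restrict_of_subset (disjointed_subset U n),
      riemVolume_restrict_source g (IsManifold.chart_mem_maximalAtlas (f n))]
    infer_instance
  infer_instance

theorem riemVolume_singleton [T1Space X] (g : RiemMetric d X) (hd : d ≠ 0) (x : X) :
    riemVolume g {x} = 0 := by
  have : Nonempty (Fin d) := ⟨⟨0, Nat.pos_of_ne_zero hd⟩⟩
  set e := chartAt (EuclideanSpace ℝ (Fin d)) x
  rw [riemVolume_apply_of_subset g (IsManifold.chart_mem_maximalAtlas x) (measurableSet_singleton x)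
    (singleton_subset_iff.2 (mem_chart_source _ x)),
    chartVolume_apply g _ (measurableSet_singleton x)]
  refine setLIntegral_measure_zero _ _ (measure_mono_null (t := {e x}) ?_ (measure_singleton _))
  rintro y ⟨hy, hyx⟩
  have : e.symm y = x := hyx
  rw [mem_singleton_iff, ← this, e.right_inv hy]

end RiemannianVolume

/-! ### The Jacobian and the image of Riemannian volume under a diffeomorphism -/

section Jacobian

variable {d : ℕ} {X : Type*} [TopologicalSpace X] [ChartedSpace (EuclideanSpace ℝ (Fin d)) X]
  [IsManifold (𝓡 d) ∞ X]

theorem gramVolume_chart_symm_pos (g : RiemMetric d X)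
    {e : OpenPartialHomeomorph X (EuclideanSpace ℝ (Fin d))}
    (he : e ∈ IsManifold.maximalAtlas (𝓡 d) ∞ X) {y : EuclideanSpace ℝ (Fin d)}
    (hy : y ∈ e.target) :
    0 < gramVolume g (e.symm y) fun i =>
      mfderiv 𝓘(ℝ, EuclideanSpace ℝ (Fin d)) (𝓡 d) e.symm y (stdVec i) := by
  have hsymm := (contMDiffAt_symm_of_mem_maximalAtlas he hy).mdifferentiableAt (n := ∞) (by simp)
  have hdir := (contMDiffAt_of_mem_maximalAtlas he (e.map_target hy)).mdifferentiableAt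
    (n := ∞) (by simp)
  have h := gramVolume_map g (e.symm y) (mfderiv (𝓡 d) (𝓡 d) e.symm y)
  refine lt_of_lt_of_eq (mul_pos (abs_pos.2 ?_) (gramVolume_stdVec_pos g (e.symm y))) h.symm
  have hid : mfderiv (𝓡 d) (𝓡 d) (e ∘ e.symm) y = ContinuousLinearMap.id ℝ _ := by
    have : e ∘ e.symm =ᶠ[nhds y] id := by
      filter_upwards [e.open_target.mem_nhds hy] with z hz
      exact e.right_inv hz
    rw [this.mfderiv_eq]
    exact mfderiv_id
  rw [mfderiv_comp y hdir hsymm] at hid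
  let S : EuclideanSpace ℝ (Fin d) →L[ℝ] EuclideanSpace ℝ (Fin d) := mfderiv (𝓡 d) (𝓡 d) e.symm y
  let T : EuclideanSpace ℝ (Fin d) →L[ℝ] EuclideanSpace ℝ (Fin d) :=
    mfderiv (𝓡 d) (𝓡 d) e (e.symm y)
  have h1 : T.comp S = ContinuousLinearMap.id ℝ _ := hid
  have h3 : T.det * S.det = 1 := by
    rw [← LinearMap.det_id (A := ℝ) (M := EuclideanSpace ℝ (Fin d))]
    have := congrArg ContinuousLinearMap.det h1
    simpa [ContinuousLinearMap.det, LinearMap.det_comp] using this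
  exact fun h0 => by
    have h0' : S.det = 0 := h0
    simp [h0'] at h3

theorem jacobian_chart_symm (g : RiemMetric d X) (ψ : X ≃ₘ^∞⟮𝓡 d, 𝓡 d⟯ X)
    {e : OpenPartialHomeomorph X (EuclideanSpace ℝ (Fin d))}
    (he : e ∈ IsManifold.maximalAtlas (𝓡 d) ∞ X) {y : EuclideanSpace ℝ (Fin d)}
    (hy : y ∈ e.target) :
    gramVolume g (ψ.symm (e.symm y)) (fun i =>
      mfderiv (𝓡 d) (𝓡 d) (ψ.symm ∘ e.symm) y (stdVec i)) =
    gramVolume g (ψ.symm (e.symm y)) (fun i => mfderiv (𝓡 d) (𝓡 d) ψ.symm (e.symm y) (stdVec i)) /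
      gramVolume g (e.symm y) (fun i => (stdVec i : EuclideanSpace ℝ (Fin d))) *
    gramVolume g (e.symm y) (fun i => mfderiv (𝓡 d) (𝓡 d) e.symm y (stdVec i)) :=
  gramVolume_mfderiv_comp' g
    ((contMDiffAt_symm_of_mem_maximalAtlas he hy).mdifferentiableAt (n := ∞) (by simp))
    (ψ.symm.contMDiff.mdifferentiable (by simp) _)

/-- Numerator and denominator are both taken in preferred charts and need not be continuous
separately. Inside one fixed chart the ratio equals a quotient of Gram volumes along `ψ.symm ∘
e.symm` and `e.symm`, which are continuous. -/
theorem continuous_jacobian (g : RiemMetric d X) (ψ : X ≃ₘ^∞⟮𝓡 d, 𝓡 d⟯ X) :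
    Continuous (jacobian g ψ) := by
  refine ENNReal.continuous_ofReal.comp (continuous_iff_continuousAt.2 fun x => ?_)
  set e := chartAt (EuclideanSpace ℝ (Fin d)) x
  have he : e ∈ IsManifold.maximalAtlas (𝓡 d) ∞ X := IsManifold.chart_mem_maximalAtlas x
  have hx : x ∈ e.source := mem_chart_source _ x
  have h1 := continuousOn_gramVolume_mfderiv g e.open_target
    (contMDiffOn_symm_of_mem_maximalAtlas he)
  have h2 := continuousOn_gramVolume_mfderiv g e.open_target
    (ψ.symm.contMDiff.comp_contMDiffOn (contMDiffOn_symm_of_mem_maximalAtlas he))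
  have h3 := (h2.div h1 fun y hy => (gramVolume_chart_symm_pos g he hy).ne').comp
    e.continuousOn fun z hz => e.map_source hz
  refine ((h3.congr fun z hz => ?_).continuousAt (e.open_source.mem_nhds hx))
  have h4 := jacobian_chart_symm g ψ he (e.map_source hz)
  have h5 := (gramVolume_chart_symm_pos g he (e.map_source hz)).ne'
  have h6 := (eq_div_iff h5).2 h4.symm
  let F : X → ℝ := fun x =>
    gramVolume g (ψ.symm x) (fun i => mfderiv (𝓡 d) (𝓡 d) ψ.symm x (stdVec i)) /
      gramVolume g x (fun i => (stdVec i : EuclideanSpace ℝ (Fin d)))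
  exact (congrArg F (e.left_inv hz)).symm.trans h6

theorem jacobian_eq_one (g : RiemMetric d X) (ψ : X ≃ₘ^∞⟮𝓡 d, 𝓡 d⟯ X) {x : X}
    (h : ∀ᶠ y in nhds x, ψ.symm y = y) : jacobian g ψ x = 1 := by
  have hd : mfderiv (𝓡 d) (𝓡 d) ψ.symm x = mfderiv (𝓡 d) (𝓡 d) (id : X → X) x :=
    Filter.EventuallyEq.mfderiv_eq (f₁ := ψ.symm) (f := id) h
  have h0 := (gramVolume_stdVec_pos g x).ne'
  have hd' : (mfderiv (𝓡 d) (𝓡 d) ψ.symm x :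
      EuclideanSpace ℝ (Fin d) →L[ℝ] EuclideanSpace ℝ (Fin d)) = ContinuousLinearMap.id ℝ _ :=
    hd.trans mfderiv_id
  have h1 : gramVolume g (ψ.symm x) (fun i => mfderiv (𝓡 d) (𝓡 d) ψ.symm x (stdVec i)) =
      gramVolume g (ψ.symm x) (fun i => (stdVec i : EuclideanSpace ℝ (Fin d))) :=
    congrArg (fun T : EuclideanSpace ℝ (Fin d) →L[ℝ] EuclideanSpace ℝ (Fin d) =>
      gramVolume g (ψ.symm x) fun i => (T (stdVec i) : EuclideanSpace ℝ (Fin d))) hd'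
  have h2 : gramVolume g (ψ.symm x) (fun i => (stdVec i : EuclideanSpace ℝ (Fin d))) =
      gramVolume g x (fun i => (stdVec i : EuclideanSpace ℝ (Fin d))) := by
    rw [h.self_of_nhds]
  unfold jacobian
  rw [h1, h2, div_self h0, ENNReal.ofReal_one]

variable [MeasurableSpace X] [BorelSpace X]

theorem setLIntegral_riemVolume (g : RiemMetric d X)
    {e : OpenPartialHomeomorph X (EuclideanSpace ℝ (Fin d))}
    (he : e ∈ IsManifold.maximalAtlas (𝓡 d) ∞ X) {A : Set X} (hA : MeasurableSet A)
    (h : A ⊆ e.source) {f : X → ℝ≥0∞} (hf : Measurable f) :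
    ∫⁻ x in A, f x ∂(riemVolume g) =
      ∫⁻ y in e.target ∩ e.symm ⁻¹' A, chartVolumeDensity g e y * f (e.symm y) := by
  have hT := e.open_target.measurableSet
  have hS : MeasurableSet (e.target ∩ e.symm ⁻¹' A) :=
    e.continuousOn_symm.measurableSet_inter_preimage hT hA
  rw [← Measure.restrict_restrict_of_subset h, riemVolume_restrict_source g he,
    Measure.restrict_restrict_of_subset h, chartVolume,
    Measure.restrict_map_of_aemeasurable (aemeasurable_symm_withDensity e _) hA,
    lintegral_map' hf.aemeasurable ((aemeasurable_symm_withDensity e _).mono_measure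
      Measure.restrict_le_self)]
  rw [restrict_withDensity', Measure.restrict_restrict' hT, inter_comm,
    lintegral_withDensity_eq_lintegral_mul₀]
  · rfl
  · exact ((continuousOn_chartVolumeDensity g he).mono inter_subset_left).aemeasurable hS
  · exact hf.comp_aemeasurable
      ((e.continuousOn_symm.mono inter_subset_left).aemeasurable hS)

theorem map_riemVolume [SecondCountableTopology X] (g : RiemMetric d X)
    (ψ : X ≃ₘ^∞⟮𝓡 d, 𝓡 d⟯ X) :
    (riemVolume g).map ψ = (riemVolume g).withDensity (jacobian g ψ) := by
  obtain ⟨s, hs, hcov⟩ := exists_countable_charts (d := d) (X := X)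
  have : Countable s := hs
  refine Measure.ext_iff_of_iUnion_eq_univ (ι := s)
    (s := fun x => (chartAt (EuclideanSpace ℝ (Fin d)) x.1).source) (by
      rw [← hcov, biUnion_eq_iUnion]) |>.2 ?_
  rintro ⟨x, -⟩
  set e := chartAt (EuclideanSpace ℝ (Fin d)) x
  have he : e ∈ IsManifold.maximalAtlas (𝓡 d) ∞ X := IsManifold.chart_mem_maximalAtlas x
  -- The chart `e ∘ ψ` gives `ψ⁻¹ A` the same coordinate set as `e` gives `A`, so only the densities
  -- have to be compared.
  let e' : OpenPartialHomeomorph X (EuclideanSpace ℝ (Fin d)) :=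
    ψ.toHomeomorph.transOpenPartialHomeomorph e
  have he' : e' ∈ IsManifold.maximalAtlas (𝓡 d) ∞ X := by
    refine e'.mem_maximalAtlas_of_contMDiffOn ?_ ?_
    · exact (contMDiffOn_of_mem_maximalAtlas he).comp (ψ.contMDiff.contMDiffOn (s := e'.source))
        (fun z (hz : z ∈ e'.source) => hz)
    · exact ψ.symm.contMDiff.comp_contMDiffOn (contMDiffOn_symm_of_mem_maximalAtlas he)
  ext A hA
  have hAs := hA.inter e.open_source.measurableSet
  have hsub : ψ ⁻¹' (A ∩ e.source) ⊆ e'.source := fun z hz => hz.2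
  rw [Measure.restrict_apply hA, Measure.restrict_apply hA, withDensity_apply _ hAs,
    setLIntegral_riemVolume g he hAs inter_subset_right (continuous_jacobian g ψ).measurable,
    Measure.map_apply ψ.continuous.measurable hAs,
    riemVolume_apply_of_subset g he' (ψ.continuous.measurable hAs) hsub,
    chartVolume_apply g e' (ψ.continuous.measurable hAs)]
  have hset : e'.target ∩ e'.symm ⁻¹' (ψ ⁻¹' (A ∩ e.source)) =
      e.target ∩ e.symm ⁻¹' (A ∩ e.source) := by
    ext y
    change y ∈ e.target ∧ ψ (ψ.symm (e.symm y)) ∈ A ∩ e.source ↔ y ∈ e.target ∧ e.symm y ∈ A ∩ e.source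
    rw [ψ.apply_symm_apply]
  rw [hset]
  refine setLIntegral_congr_fun (e.continuousOn_symm.measurableSet_inter_preimage
    e.open_target.measurableSet hAs) fun y hy => ?_
  have h4 := jacobian_chart_symm g ψ he hy.1
  have h5 := (gramVolume_chart_symm_pos g he hy.1).le
  refine (congrArg ENNReal.ofReal h4).trans ?_
  rw [ENNReal.ofReal_mul' h5, mul_comm]
  rfl

end Jacobian

/-! ### Void events generate the σ-algebra -/

section Counting

variable {X M : Type*} [TopologicalSpace X]

theorem finite_inter_of_subset (ξ : MarkedConfig X M) {B : Set (X × M)} {K : Set X}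
    (hK : IsCompact K) (hB : B ⊆ K ×ˢ univ) : (ξ.1 ∩ B).Finite := by
  refine Finite.of_finite_image ((ξ.2.2 K hK).subset ?_) (ξ.2.1.mono inter_subset_left)
  rintro _ ⟨z, ⟨hz, hzB⟩, rfl⟩
  exact ⟨⟨z, hz, rfl⟩, (hB hzB).1⟩

theorem count_eq_zero_iff {B : Set (X × M)} {K : Set X} (hK : IsCompact K) (hB : B ⊆ K ×ˢ univ)
    (ξ : MarkedConfig X M) : count B ξ = 0 ↔ ∀ z ∈ ξ.1, z ∉ B := by
  rw [count, ncard_eq_zero (finite_inter_of_subset ξ hK hB), eq_empty_iff_forall_notMem]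
  simp

theorem count_restrict (Λ : Set X) (B : Set (X × M)) (ξ : MarkedConfig X M) :
    count B (restrict Λ ξ) = count (B ∩ Λ ×ˢ univ) ξ := by
  simp only [count, restrict]
  rw [inter_assoc, inter_comm B]

/-- The finitely many points in `B` have distinct positions, so finitely many binary digits of
`mapNatBool` separate them. From then on each occupied cell holds exactly one point, and the
sequence is constant. -/
theorem tendsto_card_cells [T2Space X] [SecondCountableTopology X] [MeasurableSpace X]
    [BorelSpace X] (ξ : MarkedConfig X M)
    {B : Set (X × M)} {K : Set X}
    (hK : IsCompact K) (hBK : B ⊆ K ×ˢ univ) :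
    Filter.Tendsto (fun n => ∑ c : Fin n → Bool,
      if count (B ∩ {x | ∀ i : Fin n, MeasurableSpace.mapNatBool X x i = c i} ×ˢ univ) ξ = 0
      then 0 else 1) Filter.atTop (nhds (count B ξ)) := by
  classical
  have hF := finite_inter_of_subset ξ hK hBK
  refine tendsto_const_nhds.congr' ?_
  have hsep : ∀ᶠ n : ℕ in Filter.atTop, ∀ z ∈ ξ.1 ∩ B, ∀ w ∈ ξ.1 ∩ B,
      (∀ i : Fin n, MeasurableSpace.mapNatBool X z.1 i = MeasurableSpace.mapNatBool X w.1 i) →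
      z = w := by
    refine (Filter.eventually_all_finite hF).2 fun z hz =>
      (Filter.eventually_all_finite hF).2 fun w hw => ?_
    by_cases hzw : z = w
    · exact Filter.Eventually.of_forall fun _ _ => hzw
    have h1 : MeasurableSpace.mapNatBool X z.1 ≠ MeasurableSpace.mapNatBool X w.1 := fun h =>
      hzw (ξ.2.1 hz.1 hw.1 (MeasurableSpace.injective_mapNatBool X h))
    obtain ⟨k, hk⟩ := Function.ne_iff.1 h1
    filter_upwards [Filter.eventually_gt_atTop k] with n hn h
    exact absurd (h ⟨k, hn⟩) hk
  filter_upwards [hsep] with n hn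
  let φ : X × M → Fin n → Bool := fun z i => MeasurableSpace.mapNatBool X z.1 i
  have h1 : ∀ c : Fin n → Bool,
      count (B ∩ {x | ∀ i : Fin n, MeasurableSpace.mapNatBool X x i = c i} ×ˢ univ) ξ = 0 ↔
        c ∉ hF.toFinset.image φ := by
    intro c
    rw [count_eq_zero_iff hK (inter_subset_left.trans hBK)]
    simp only [Finset.mem_image, Finite.mem_toFinset, not_exists, not_and, mem_inter_iff,
      mem_prod, mem_ofPred_eq, mem_univ, and_true, and_imp]
    refine forall_congr' fun z => forall_congr' fun _ => forall_congr' fun _ => ?_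
    exact not_congr (funext_iff (f := φ z)).symm
  simp_rw [h1, ite_not]
  rw [Finset.sum_ite_mem, Finset.univ_inter, Finset.sum_const, smul_eq_mul, mul_one,
    Finset.card_image_of_injOn, count, ncard_eq_toFinset_card _ hF]
  intro z hz w hw h
  exact hn z (by simpa using hz) w (by simpa using hw) fun i => congrFun h i

variable [MeasurableSpace X] [MeasurableSpace M]

theorem measurable_count_of_mem_boundedSets {B : Set (X × M)} (hB : B ∈ boundedSets) :
    Measurable (count B : MarkedConfig X M → ℕ) :=
  measurable_iff_comap_le.2 (le_iSup₂_of_le B hB le_rfl)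

theorem measurable_of_measurable_natCast_ennreal {α : Type*} [MeasurableSpace α] {f : α → ℕ}
    (h : Measurable fun x => (f x : ℝ≥0∞)) : Measurable f := by
  refine measurable_to_countable' fun n => ?_
  have : f ⁻¹' {n} = (fun x => (f x : ℝ≥0∞)) ⁻¹' {(n : ℝ≥0∞)} := by ext; simp
  rw [this]
  exact h (measurableSet_singleton _)

theorem ncard_eq_count_top {α : Type*} {s : Set α} (hs : s.Finite) :
    (s.ncard : ℝ≥0∞) = @Measure.count α ⊤ s := by
  let : MeasurableSpace α := ⊤
  rw [Measure.count_apply_finite s hs, ncard_eq_toFinset_card s hs]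

/-- The Borel subsets of `X × M` whose projection to `X` is relatively compact. -/
def relCompactSets (X M : Type*) [TopologicalSpace X] [MeasurableSpace X] [MeasurableSpace M] :
    Set (Set (X × M)) :=
  {B | MeasurableSet B ∧ ∃ K : Set X, IsCompact K ∧ B ⊆ K ×ˢ univ}

/-- The events that no point lies in a given set with relatively compact projection. -/
def voidEvents (X M : Type*) [TopologicalSpace X] [MeasurableSpace X] [MeasurableSpace M] :
    Set (Set (MarkedConfig X M)) :=
  (fun B => {ξ | count B ξ = 0}) '' relCompactSets X M

theorem isPiSystem_voidEvents : IsPiSystem (voidEvents X M) := by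
  rintro _ ⟨B, ⟨hB, K, hK, hBK⟩, rfl⟩ _ ⟨C, ⟨hC, L, hL, hCL⟩, rfl⟩ -
  have hKL : B ∪ C ⊆ (K ∪ L) ×ˢ univ := by
    rw [union_prod]; exact union_subset_union hBK hCL
  refine ⟨B ∪ C, ⟨hB.union hC, K ∪ L, hK.union hL, hKL⟩, ?_⟩
  ext ξ
  simp only [mem_ofPred_eq, mem_inter_iff, count_eq_zero_iff hK hBK, count_eq_zero_iff hL hCL,
    count_eq_zero_iff (hK.union hL) hKL, mem_union, not_or]
  exact ⟨fun h => ⟨fun z hz => (h z hz).1, fun z hz => (h z hz).2⟩, fun h z hz => ⟨h.1 z hz, h.2 z hz⟩⟩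

variable [T2Space X] [BorelSpace X]

/-- The σ-algebra is generated by sets whose projection is Borel, and projections of Borel sets need
not be. Rectangles inside `K × M` cause no trouble, and a Dynkin argument extends measurability to
all measurable subsets of `K × M`. -/
theorem measurable_count {B : Set (X × M)} (hBm : MeasurableSet B) {K : Set X}
    (hK : IsCompact K) (hB : B ⊆ K ×ˢ univ) : Measurable (count B : MarkedConfig X M → ℕ) := by
  suffices h : ∀ B : Set (X × M), MeasurableSet B →
      Measurable (count (B ∩ K ×ˢ univ) : MarkedConfig X M → ℕ) by
    have := h B hBm
    rwa [inter_eq_left.2 hB] at this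
  have hfin : ∀ (ξ : MarkedConfig X M) (B : Set (X × M)), (ξ.1 ∩ (B ∩ K ×ˢ univ)).Finite :=
    fun ξ B => finite_inter_of_subset ξ hK inter_subset_right
  have hrect : ∀ (A : Set X) (C : Set M), MeasurableSet A → MeasurableSet C →
      Measurable (count (A ×ˢ C ∩ K ×ˢ univ) : MarkedConfig X M → ℕ) := by
    intro A C hA hC
    refine measurable_count_of_mem_boundedSets ?_
    rw [prod_inter_prod, inter_univ]
    rcases C.eq_empty_or_nonempty with rfl | hCne
    · simp [boundedSets]
    · refine ⟨(hA.inter hK.measurableSet).prod hC, ?_, ?_⟩ <;> rw [fst_image_prod _ hCne]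
      · exact hA.inter hK.measurableSet
      · exact hK.of_isClosed_subset isClosed_closure
          (hK.isClosed.closure_subset_iff.2 inter_subset_right)
  intro B hB
  induction B, hB using MeasurableSpace.induction_on_inter generateFrom_prod.symm isPiSystem_prod with
  | empty =>
    have h0 : (count (∅ ∩ K ×ˢ univ) : MarkedConfig X M → ℕ) = fun _ => 0 := by
      ext ξ; simp [count]
    rw [h0]
    exact measurable_const
  | basic t ht =>
    obtain ⟨A, hA, C, hC, rfl⟩ := ht
    exact hrect A C hA hC
  | compl t ht ih =>
    have h1 : ∀ ξ : MarkedConfig X M, count (tᶜ ∩ K ×ˢ univ) ξ =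
        count (univ ×ˢ univ ∩ K ×ˢ univ) ξ - count (t ∩ K ×ˢ univ) ξ := by
      intro ξ
      simp only [count]
      rw [← ncard_sdiff (inter_subset_inter_right _ (inter_subset_inter_left _ (by simp)))
        (hfin ξ t)]
      congr 1
      ext z
      simp only [mem_inter_iff, mem_compl_iff, mem_sdiff]
      tauto
    simp_rw [funext h1]
    exact (hrect univ univ .univ .univ).sub ih
  | iUnion f hd hf ih =>
    refine measurable_of_measurable_natCast_ennreal ?_
    have h1 : ∀ ξ : MarkedConfig X M, (count ((⋃ i, f i) ∩ K ×ˢ univ) ξ : ℝ≥0∞) =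
        ∑' i, (count (f i ∩ K ×ˢ univ) ξ : ℝ≥0∞) := by
      intro ξ
      -- Counting measure on the discrete σ-algebra supplies countable additivity of cardinalities.
      let : MeasurableSpace (X × M) := ⊤
      simp only [count]
      rw [ncard_eq_count_top (hfin ξ _), iUnion_inter, inter_iUnion, measure_iUnion]
      · exact tsum_congr fun i => (ncard_eq_count_top (hfin ξ _)).symm
      · exact hd.mono fun i j h => h.mono (fun z hz => hz.2.1) (fun z hz => hz.2.1)
      · exact fun _ => trivial
    simp_rw [h1]
    exact Measurable.tsum fun i => measurable_from_top.comp (ih i)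

theorem measurableSet_void {B : Set (X × M)} (hB : B ∈ relCompactSets X M) :
    MeasurableSet {ξ : MarkedConfig X M | count B ξ = 0} := by
  obtain ⟨hBm, K, hK, hBK⟩ := hB
  exact measurable_count hBm hK hBK (measurableSet_singleton 0)

theorem generateFrom_voidEvents [SecondCountableTopology X] :
    MeasurableSpace.generateFrom (voidEvents X M) =
      (inferInstance : MeasurableSpace (MarkedConfig X M)) := by
  refine le_antisymm (MeasurableSpace.generateFrom_le ?_) (iSup₂_le fun B hB => ?_)
  · rintro _ ⟨B, hB, rfl⟩
    exact measurableSet_void hB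
  · rw [← measurable_iff_comap_le]
    have hBK : B ⊆ closure (Prod.fst '' B) ×ˢ univ := fun z hz =>
      ⟨subset_closure (mem_image_of_mem _ hz), trivial⟩
    -- From here measurability refers to the σ-algebra of void events; the number of occupied cells
    -- is measurable for it, hence so is its limit `count B`.
    let : MeasurableSpace (MarkedConfig X M) := MeasurableSpace.generateFrom (voidEvents X M)
    refine measurable_of_tendsto_metrizable (f := fun n ξ => ∑ c : Fin n → Bool,
      if count (B ∩ {x | ∀ i : Fin n, MeasurableSpace.mapNatBool X x i = c i} ×ˢ univ) ξ = 0
      then 0 else 1) (fun n => ?_) (tendsto_pi_nhds.2 fun ξ => tendsto_card_cells ξ hB.2.2 hBK)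
    refine Finset.measurable_sum _ fun c _ => Measurable.ite ?_ measurable_const measurable_const
    refine MeasurableSpace.measurableSet_generateFrom (mem_image_of_mem _
      ⟨hB.1.inter (MeasurableSet.prod ?_ .univ), _, hB.2.2, inter_subset_left.trans hBK⟩)
    rw [ofPred_forall]
    exact MeasurableSet.iInter fun i => (measurable_pi_iff.1
      (MeasurableSpace.measurable_mapNatBool X) i) (measurableSet_singleton (c i))

/-- A finite measure on the marked configuration space is determined by its void probabilities. -/
theorem ext_of_void [SecondCountableTopology X] {P P' : Measure (MarkedConfig X M)}
    [IsFiniteMeasure P]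
    (h : ∀ B ∈ relCompactSets X M, P {ξ | count B ξ = 0} = P' {ξ | count B ξ = 0}) : P = P' := by
  refine ext_of_generate_finite _ generateFrom_voidEvents.symm isPiSystem_voidEvents ?_ ?_
  · rintro _ ⟨B, hB, rfl⟩
    exact h B hB
  -- The void event of `∅` is the whole space, so equality of total masses is included in `h`.
  · have := h ∅ ⟨.empty, ∅, isCompact_empty, empty_subset _⟩
    simpa [count] using this

theorem measurable_of_void [SecondCountableTopology X] {α : Type*} [MeasurableSpace α]
    {F : α → MarkedConfig X M}
    (h : ∀ B ∈ relCompactSets X M, MeasurableSet {a | count B (F a) = 0}) : Measurable F := by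
  have : Measurable[_, MeasurableSpace.generateFrom (voidEvents X M)] F := by
    refine measurable_generateFrom ?_
    rintro _ ⟨B, hB, rfl⟩
    exact h B hB
  rwa [generateFrom_voidEvents] at this

theorem measurable_restrict [SecondCountableTopology X] {Λ : Set X} (hΛ : MeasurableSet Λ) :
    Measurable (restrict Λ : MarkedConfig X M → MarkedConfig X M) := by
  refine measurable_of_void fun B ⟨hB, K, hK, hBK⟩ => ?_
  simp_rw [count_restrict]
  exact measurableSet_void ⟨hB.inter (hΛ.prod .univ), K, hK, inter_subset_left.trans hBK⟩

end Counting

/-! ### Products over the points of a configuration -/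

theorem _root_.ENNReal.iSup_mul_iSup_of_monotone {f g : ℕ → ℝ≥0∞} (hf : Monotone f)
    (hg : Monotone g) : (⨆ n, f n) * ⨆ n, g n = ⨆ n, f n * g n := by
  refine le_antisymm ?_ (iSup_le fun n => mul_le_mul' (le_iSup f n) (le_iSup g n))
  rw [ENNReal.iSup_mul]
  refine iSup_le fun i => ?_
  rw [ENNReal.mul_iSup]
  refine iSup_le fun j => ?_
  exact le_iSup_of_le (max i j) (mul_le_mul' (hf (le_max_left i j)) (hg (le_max_right i j)))

theorem _root_.ENNReal.prod_iSup_of_monotone {ι : Type*} (s : Finset ι) {f : ℕ → ι → ℝ≥0∞}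
    (hf : Monotone f) : ∏ i ∈ s, ⨆ n, f n i = ⨆ n, ∏ i ∈ s, f n i := by
  classical
  induction s using Finset.induction_on with
  | empty => simp
  | insert a s ha ih =>
    simp_rw [Finset.prod_insert ha]
    rw [ih, ENNReal.iSup_mul_iSup_of_monotone (fun m n h => hf h a)
      fun m n h => Finset.prod_le_prod' fun i _ => hf h i]

section Product

variable {X M : Type*} [TopologicalSpace X]

/-- The product of the values of `u` over the points of a marked configuration. -/
def prodOver (u : X × M → ℝ≥0∞) (ξ : MarkedConfig X M) : ℝ≥0∞ := ∏ᶠ z ∈ ξ.1, u z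

theorem prodOver_eq {u : X × M → ℝ≥0∞} {K : Set X} (hK : IsCompact K)
    (hu : ∀ z : X × M, z.1 ∉ K → u z = 1) (ξ : MarkedConfig X M) :
    prodOver u ξ = ∏ z ∈ (finite_inter_of_subset ξ hK Subset.rfl).toFinset, u z := by
  refine finprod_mem_eq_prod_of_inter_mulSupport_eq _ ?_
  ext z
  simp only [mem_inter_iff, Function.mem_mulSupport, Finite.coe_toFinset, mem_prod, mem_univ,
    and_true]
  refine ⟨fun h => ⟨⟨h.1, by_contra fun hz => h.2 (hu z hz)⟩, h.2⟩, fun h => ⟨h.1.1, h.2⟩⟩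

theorem prodOver_restrict {u : X × M → ℝ≥0∞} {Λ : Set X}
    (hu : ∀ z : X × M, z.1 ∉ Λ → u z = 1) (ξ : MarkedConfig X M) :
    prodOver u (restrict Λ ξ) = prodOver u ξ := by
  refine finprod_mem_inter_mulSupport_eq _ _ _ ?_
  ext z
  simp only [restrict, mem_inter_iff, mem_prod, mem_univ, and_true, Function.mem_mulSupport]
  exact ⟨fun h => ⟨h.1.1, h.2⟩, fun h => ⟨⟨h.1, by_contra fun hz => h.2 (hu z hz)⟩, h.2⟩⟩

/-- A point in `B` contributes the factor `0`. This turns void probabilities of a measure with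
density `prodOver u` into integrals of products. -/
theorem prodOver_compl_indicator {u : X × M → ℝ≥0∞} {K : Set X} (hK : IsCompact K)
    (hu : ∀ z : X × M, z.1 ∉ K → u z = 1) {B : Set (X × M)} (hB : B ⊆ K ×ˢ univ) :
    prodOver (Bᶜ.indicator u) = {ξ : MarkedConfig X M | count B ξ = 0}.indicator (prodOver u) := by
  have hu' : ∀ z : X × M, z.1 ∉ K → Bᶜ.indicator u z = 1 := fun z hz => by
    rw [indicator_of_mem (show z ∈ Bᶜ from fun h => hz (hB h).1), hu z hz]
  ext ξ
  rw [prodOver_eq hK hu']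
  by_cases h : count B ξ = 0
  · rw [indicator_of_mem (by exact h), prodOver_eq hK hu]
    refine Finset.prod_congr rfl fun z hz => indicator_of_mem ?_ _
    exact (count_eq_zero_iff hK hB ξ).1 h z (by simp at hz; exact hz.1)
  · rw [indicator_of_notMem (by exact h)]
    rw [count_eq_zero_iff hK hB] at h
    push Not at h
    obtain ⟨z, hz, hzB⟩ := h
    refine Finset.prod_eq_zero (i := z) ?_ (by simp [hzB])
    simpa using ⟨hz, (hB hzB).1⟩

variable [T2Space X] [MeasurableSpace X] [BorelSpace X] [MeasurableSpace M]

/-- For a simple function the product is a finite product of powers `c ^ count`, with the count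
taken in a level set. The general case is a monotone limit, with which finite products commute. -/
theorem measurable_prodOver {u : X × M → ℝ≥0∞} (hum : Measurable u) {K : Set X}
    (hK : IsCompact K) (hu : ∀ z : X × M, z.1 ∉ K → u z = 1) :
    Measurable (prodOver u : MarkedConfig X M → ℝ≥0∞) := by
  have hs : ∀ s : SimpleFunc (X × M) ℝ≥0∞, Measurable fun ξ : MarkedConfig X M =>
      ∏ z ∈ (finite_inter_of_subset ξ hK Subset.rfl).toFinset, s z := by
    intro s
    classical
    have h1 : ∀ ξ : MarkedConfig X M,
        ∏ z ∈ (finite_inter_of_subset ξ hK Subset.rfl).toFinset, s z =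
          ∏ c ∈ s.range, c ^ count (s ⁻¹' {c} ∩ K ×ˢ univ) ξ := by
      intro ξ
      rw [← Finset.prod_fiberwise_of_maps_to (t := s.range) (g := s)
        (fun z _ => s.mem_range_self z)]
      refine Finset.prod_congr rfl fun c _ => ?_
      rw [Finset.prod_congr rfl (g := fun _ => c) (fun z hz => (Finset.mem_filter.1 hz).2),
        Finset.prod_const]
      congr 1
      rw [count, ncard_eq_toFinset_card _ (finite_inter_of_subset ξ hK inter_subset_right)]
      congr 1
      ext z
      simp only [Finset.mem_filter, Finite.mem_toFinset, mem_inter_iff, mem_preimage,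
        mem_singleton_iff]
      tauto
    simp_rw [h1]
    refine Finset.measurable_prod _ fun c _ => ?_
    exact (measurable_from_top (f := fun n : ℕ => c ^ n)).comp
      (measurable_count ((s.measurableSet_preimage {c}).inter
        (hK.measurableSet.prod .univ)) hK inter_subset_right)
  have h2 : ∀ ξ : MarkedConfig X M, prodOver u ξ = ⨆ n,
      ∏ z ∈ (finite_inter_of_subset ξ hK Subset.rfl).toFinset, SimpleFunc.eapprox u n z := by
    intro ξ
    rw [prodOver_eq hK hu, ← ENNReal.prod_iSup_of_monotone _
      (f := fun n z => SimpleFunc.eapprox u n z) (fun m n h => SimpleFunc.monotone_eapprox u h)]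
    exact Finset.prod_congr rfl fun z _ => (SimpleFunc.iSup_eapprox_apply hum z).symm
  simp_rw [funext h2]
  exact Measurable.iSup fun n => hs _

end Product

/-! ### Integration against the Poisson measure in a window -/

section Tuples

variable {X M : Type*} [TopologicalSpace X]

theorem ofTuple_val {n : ℕ} {z : Fin n → X × M} (hz : Function.Injective fun i => (z i).1) :
    (ofTuple n z).1 = range z :=
  congrArg Subtype.val (dif_pos hz)

theorem prodOver_ofTuple (u : X × M → ℝ≥0∞) {n : ℕ} {z : Fin n → X × M}
    (hz : Function.Injective fun i => (z i).1) : prodOver u (ofTuple n z) = ∏ i, u (z i) := by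
  have hz' : Function.Injective z := fun i j h => hz (congrArg Prod.fst h)
  rw [prodOver, ofTuple_val hz, finprod_mem_range hz', finprod_eq_prod_of_fintype]

variable [T2Space X] [SecondCountableTopology X] [MeasurableSpace X] [BorelSpace X]
  [MeasurableSpace M]

theorem measurableSet_injective (n : ℕ) :
    MeasurableSet {z : Fin n → X × M | Function.Injective fun i => (z i).1} := by
  have : {z : Fin n → X × M | Function.Injective fun i => (z i).1} =
      ⋂ i, ⋂ j, ⋂ _ : i ≠ j, {z | (z i).1 = (z j).1}ᶜ := by
    ext z
    simp only [mem_ofPred_eq, mem_iInter, mem_compl_iff, Function.Injective]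
    exact ⟨fun h i j hij he => hij (h he), fun h i j he => by_contra fun hij => h i j hij he⟩
  rw [this]
  refine MeasurableSet.iInter fun i => MeasurableSet.iInter fun j => MeasurableSet.iInter fun _ =>
    (measurableSet_eq_fun ?_ ?_).compl <;> fun_prop

theorem measurable_ofTuple (n : ℕ) :
    Measurable (ofTuple n : (Fin n → X × M) → MarkedConfig X M) := by
  refine measurable_of_void fun B ⟨hB, K, hK, hBK⟩ => ?_
  -- Tuples with repeated positions are sent to the empty configuration, hence always lie in the
  -- void event.
  have : {z : Fin n → X × M | count B (ofTuple n z) = 0} =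
      {z | Function.Injective fun i => (z i).1}ᶜ ∪ ⋂ i, {z | z i ∈ Bᶜ} := by
    ext z
    simp only [mem_ofPred_eq, mem_union, mem_compl_iff, mem_iInter, count_eq_zero_iff hK hBK]
    by_cases h : Function.Injective fun i => (z i).1
    · simp [ofTuple, h]
    · simp [ofTuple, h]
  rw [this]
  exact (measurableSet_injective n).compl.union
    (MeasurableSet.iInter fun i => measurable_pi_apply i hB.compl)

/-- Integrating out the `i`-th point first, a coincidence with the position of another point
confines it to a fibre over a single position, which is null. -/
theorem pi_not_injective {τ : Measure (X × M)} [SigmaFinite τ]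
    (hτ : ∀ x : X, τ ({x} ×ˢ univ) = 0) (n : ℕ) :
    (Measure.pi fun _ : Fin n => τ) {z | Function.Injective fun i => (z i).1}ᶜ = 0 := by
  have : {z : Fin n → X × M | Function.Injective fun i => (z i).1}ᶜ ⊆
      ⋃ i, ⋃ j, ⋃ _ : i ≠ j, {z | (z i).1 = (z j).1} := by
    intro z hz
    simp only [mem_compl_iff, mem_ofPred_eq, Function.Injective] at hz
    push Not at hz
    obtain ⟨i, j, h, hij⟩ := hz
    simp only [mem_iUnion]
    exact ⟨i, j, hij, h⟩
  refine measure_mono_null this ?_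
  refine measure_iUnion_null fun i => measure_iUnion_null fun j => measure_iUnion_null fun hij => ?_
  obtain _ | n := n
  · exact i.elim0
  obtain ⟨k, rfl⟩ := Fin.exists_succAbove_eq hij.symm
  have hmp := measurePreserving_piFinSuccAbove (fun _ : Fin (n + 1) => τ) i
  have hS : MeasurableSet {w : (X × M) × (Fin n → X × M) | w.1.1 = (w.2 k).1} := by
    refine measurableSet_eq_fun ?_ ?_ <;> fun_prop
  have hpre : {z : Fin (n + 1) → X × M | (z i).1 = (z (i.succAbove k)).1} =
      MeasurableEquiv.piFinSuccAbove (fun _ => X × M) i ⁻¹'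
        {w : (X × M) × (Fin n → X × M) | w.1.1 = (w.2 k).1} := by
    ext z
    rfl
  rw [hpre, hmp.measure_preimage hS.nullMeasurableSet, Measure.prod_apply_symm hS]
  refine lintegral_eq_zero_of_ae_eq_zero (Filter.Eventually.of_forall fun w => ?_)
  refine measure_mono_null ?_ (hτ (w k).1)
  intro y hy
  exact ⟨hy, trivial⟩

theorem lintegral_pi_prod {α : Type*} [MeasurableSpace α] (μ : Measure α) [SigmaFinite μ]
    {u : α → ℝ≥0∞} (hu : Measurable u) (n : ℕ) :
    ∫⁻ z, ∏ i, u (z i) ∂(Measure.pi fun _ : Fin n => μ) = (∫⁻ a, u a ∂μ) ^ n := by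
  induction n with
  | zero => simp
  | succ n ih =>
    have hmp := measurePreserving_piFinSuccAbove (fun _ : Fin (n + 1) => μ) 0
    have h1 : ∀ z : Fin (n + 1) → α, ∏ i, u (z i) =
        (fun w : α × (Fin n → α) => u w.1 * ∏ i, u (w.2 i))
          (MeasurableEquiv.piFinSuccAbove (fun _ => α) 0 z) := by
      intro z
      rw [Fin.prod_univ_succ]
      rfl
    refine (lintegral_congr h1).trans ((hmp.lintegral_comp
      (f := fun w : α × (Fin n → α) => u w.1 * ∏ i, u (w.2 i)) (by fun_prop)).trans ?_)
    rw [lintegral_prod_mul (f := u) (g := fun w : Fin n → α => ∏ i, u (w i)) hu.aemeasurable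
        (Measurable.aemeasurable (by fun_prop)), ih, pow_succ']

/-- On `n`-tuples the product integrates to the `n`-th power of `∫ u`, and the weights `1/n!` sum
these powers to an exponential. Finiteness of `∫ u` is needed to write the exponent with `toReal`.
-/
theorem lintegral_localPoisson {τ : Measure (X × M)} {Λ : Set X}
    (hfin : τ (Λ ×ˢ univ) ≠ ⊤) (hτ : ∀ x : X, τ ({x} ×ˢ univ) = 0) {u : X × M → ℝ≥0∞}
    (hum : Measurable u) {K : Set X} (hK : IsCompact K) (hu : ∀ z : X × M, z.1 ∉ K → u z = 1)
    (hint : ∫⁻ z in Λ ×ˢ univ, u z ∂τ ≠ ⊤) :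
    ∫⁻ ξ, prodOver u ξ ∂(localPoisson τ Λ) =
      ENNReal.ofReal (Real.exp ((∫⁻ z in Λ ×ˢ univ, u z ∂τ).toReal - (τ (Λ ×ˢ univ)).toReal)) := by
  have : IsFiniteMeasure (τ.restrict (Λ ×ˢ (univ : Set M))) :=
    ⟨by rw [Measure.restrict_apply_univ]; exact hfin.lt_top⟩
  have hn : ∀ n, ∫⁻ ξ, prodOver u ξ ∂(nPointMeasure τ Λ n) =
      (∫⁻ z in Λ ×ˢ univ, u z ∂τ) ^ n := by
    intro n
    have hτ' : ∀ x : X, (τ.restrict (Λ ×ˢ univ)) ({x} ×ˢ univ) = 0 := fun x =>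
      le_antisymm ((Measure.restrict_apply_le _ _).trans_eq (hτ x)) bot_le
    have hae : ∀ᵐ z ∂(Measure.pi fun _ : Fin n => τ.restrict (Λ ×ˢ univ)),
        z ∈ {z | Function.Injective fun i => (z i).1} := pi_not_injective hτ' n
    rw [nPointMeasure, lintegral_map (measurable_prodOver hum hK hu) (measurable_ofTuple n),
      ← lintegral_pi_prod _ hum,
      setLIntegral_congr_fun (measurableSet_injective n) (fun z hz => prodOver_ofTuple u hz),
      Measure.restrict_eq_self_of_ae_mem hae]
  set I := ∫⁻ z in Λ ×ˢ univ, u z ∂τ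
  have hsum : ∑' n : ℕ, (n.factorial : ℝ≥0∞)⁻¹ * I ^ n = ENNReal.ofReal (Real.exp I.toReal) := by
    have h1 := NormedSpace.expSeries_div_hasSum_exp (𝔸 := ℝ) I.toReal
    rw [← Real.exp_eq_exp_ℝ] at h1
    rw [← h1.tsum_eq, ENNReal.ofReal_tsum_of_nonneg (fun n => by positivity) h1.summable]
    refine tsum_congr fun n => ?_
    rw [ENNReal.ofReal_div_of_pos (by positivity), ENNReal.ofReal_pow ENNReal.toReal_nonneg,
      ENNReal.ofReal_toReal hint, ENNReal.ofReal_natCast, mul_comm, div_eq_mul_inv]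
  rw [localPoisson, lintegral_smul_measure, lintegral_sum_measure]
  simp_rw [lintegral_smul_measure, hn, smul_eq_mul]
  rw [hsum, ← ENNReal.ofReal_mul (Real.exp_pos _).le, ← Real.exp_add]
  congr 2
  ring

end Tuples

/-! ### Gluing along a compact exhaustion -/

theorem le_of_mem_disjointed {X : Type*} [TopologicalSpace X] (K : CompactExhaustion X) {n N : ℕ} {x : X}
    (hx : x ∈ disjointed K n) (hxN : x ∈ K N) : n ≤ N := by
  by_contra hn
  have hn' : N < n := not_le.1 hn
  rw [disjointed_eq_inter_compl] at hx
  simp only [mem_inter_iff, mem_iInter] at hx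
  exact hx.2 N hn' hxN

section Glue

variable {X M : Type*} [TopologicalSpace X]

/-- The union of the restrictions of a sequence of marked configurations to the layers of a compact
exhaustion. -/
def glue (K : CompactExhaustion X) (ξ : ℕ → MarkedConfig X M) : MarkedConfig X M :=
  ⟨⋃ n, (ξ n).1 ∩ disjointed K n ×ˢ univ, by
    rintro z hz w hw hzw
    simp only [mem_iUnion, mem_inter_iff, mem_prod, mem_univ, and_true] at hz hw
    obtain ⟨n, hzn, hzK⟩ := hz
    obtain ⟨m, hwm, hwK⟩ := hw
    have hnm : n = m := by
      by_contra hne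
      exact disjoint_left.1 (disjoint_disjointed K hne) hzK (hzw ▸ hwK)
    subst hnm
    exact (ξ n).2.1 hzn hwm hzw, by
    intro L hL
    obtain ⟨N, hN⟩ := K.exists_superset_of_isCompact hL
    refine ((finite_le_nat N).biUnion fun n _ => (ξ n).2.2 L hL).subset ?_
    rintro _ ⟨⟨z, hz, rfl⟩, hzL⟩
    simp only [mem_iUnion, mem_inter_iff, mem_prod, mem_univ, and_true] at hz
    obtain ⟨n, hzn, hzK⟩ := hz
    exact mem_biUnion (x := n) (le_of_mem_disjointed K hzK (hN hzL)) ⟨⟨z, hzn, rfl⟩, hzL⟩⟩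

theorem count_glue_eq_zero_iff (K : CompactExhaustion X) {B : Set (X × M)} {N : ℕ}
    (hB : B ⊆ K N ×ˢ univ) (ξ : ℕ → MarkedConfig X M) : count B (glue K ξ) = 0 ↔
      ∀ n ∈ Finset.range (N + 1), count (B ∩ disjointed K n ×ˢ univ) (ξ n) = 0 := by
  rw [count_eq_zero_iff (K.isCompact N) hB]
  simp_rw [count_eq_zero_iff (K.isCompact N) (inter_subset_left.trans hB)]
  constructor
  · rintro h n - z hz ⟨hzB, hzK⟩
    exact h z (mem_iUnion.2 ⟨n, hz, hzK⟩) hzB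
  · rintro h z hz hzB
    obtain ⟨n, hzn, hzK⟩ := mem_iUnion.1 hz
    exact h n (Finset.mem_range_succ_iff.2 (le_of_mem_disjointed K hzK.1 (hB hzB).1)) z hzn
      ⟨hzB, hzK⟩

variable [MeasurableSpace X] [MeasurableSpace M]

/-- The Poisson void probabilities `exp (-τ B)`. -/
def HasPoissonVoids (τ : Measure (X × M)) (P : Measure (MarkedConfig X M)) : Prop :=
  ∀ B ∈ relCompactSets X M, P {ξ | count B ξ = 0} = ENNReal.ofReal (Real.exp (-(τ B).toReal))

theorem HasPoissonVoids.isProbabilityMeasure {τ : Measure (X × M)}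
    {P : Measure (MarkedConfig X M)} (h : HasPoissonVoids τ P) : IsProbabilityMeasure P := by
  have := h ∅ ⟨.empty, ∅, isCompact_empty, empty_subset _⟩
  exact ⟨by simpa [count] using this⟩

end Glue

/-! ### Existence, void probabilities and transformation of Poisson measures -/

section Poisson

variable {X M : Type*} [TopologicalSpace X] [T2Space X] [SecondCountableTopology X]
  [MeasurableSpace X] [BorelSpace X] [MeasurableSpace M]

theorem localPoisson_void {τ : Measure (X × M)} {Λ : Set X}
    (hfin : τ (Λ ×ˢ univ) ≠ ⊤) (hτ : ∀ x : X, τ ({x} ×ˢ univ) = 0) {B : Set (X × M)}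
    (hB : B ∈ relCompactSets X M) :
    localPoisson τ Λ {ξ | count B ξ = 0} =
      ENNReal.ofReal (Real.exp (-(τ (B ∩ Λ ×ˢ univ)).toReal)) := by
  obtain ⟨hBm, K, hK, hBK⟩ := hB
  have hu : ∀ z : X × M, z.1 ∉ K → Bᶜ.indicator (1 : X × M → ℝ≥0∞) z = 1 := fun z hz => by
    rw [indicator_of_mem (show z ∈ Bᶜ from fun h => hz (hBK h).1), Pi.one_apply]
  have h1 : prodOver (Bᶜ.indicator (1 : X × M → ℝ≥0∞)) =
      {ξ : MarkedConfig X M | count B ξ = 0}.indicator 1 := by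
    rw [prodOver_compl_indicator hK (u := 1) (fun _ _ => rfl) hBK]
    congr 1
    ext ξ
    simp [prodOver]
  have hI : ∫⁻ z in Λ ×ˢ univ, Bᶜ.indicator (1 : X × M → ℝ≥0∞) z ∂τ = τ (Λ ×ˢ univ \ B) := by
    rw [lintegral_indicator_one hBm.compl, Measure.restrict_apply hBm.compl, inter_comm,
      Set.sdiff_eq]
  have hle : τ (Λ ×ˢ univ \ B) ≠ ⊤ := ne_top_of_le_ne_top hfin (measure_mono sdiff_subset)
  have h2 := lintegral_localPoisson hfin hτ (measurable_one.indicator hBm.compl) hK hu (hI ▸ hle)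
  rw [h1, lintegral_indicator_one (measurableSet_void ⟨hBm, K, hK, hBK⟩), hI] at h2
  rw [h2]
  congr 2
  have h3 := measure_inter_add_sdiff (μ := τ) (Λ ×ˢ univ) hBm
  rw [← h3, ENNReal.toReal_add (ne_top_of_le_ne_top hfin (measure_mono inter_subset_left)) hle,
    inter_comm]
  ring

theorem HasPoissonVoids.isMarkedPoisson {τ : Measure (X × M)} {P : Measure (MarkedConfig X M)}
    (h : HasPoissonVoids τ P) (hfin : ∀ Λ : Set X, MeasurableSet Λ → IsCompact (closure Λ) →
      τ (Λ ×ˢ univ) ≠ ⊤) (hτ : ∀ x : X, τ ({x} ×ˢ univ) = 0) : IsMarkedPoisson τ P := by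
  have := h.isProbabilityMeasure
  refine ⟨this, fun Λ hΛ hΛc => ?_⟩
  have hmeas := measurable_restrict (M := M) hΛ.measurableSet
  refine ext_of_void fun B hB => ?_
  rw [Measure.map_apply hmeas (measurableSet_void hB),
    localPoisson_void (hfin Λ hΛ.measurableSet hΛc) hτ hB, ← h]
  · simp_rw [preimage_ofPred_eq, count_restrict]
  · obtain ⟨hBm, K, hK, hBK⟩ := hB
    exact ⟨hBm.inter (hΛ.measurableSet.prod .univ), K, hK, inter_subset_left.trans hBK⟩

theorem IsMarkedPoisson.lintegral_prodOver {τ : Measure (X × M)} {P : Measure (MarkedConfig X M)}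
    (h : IsMarkedPoisson τ P) {u : X × M → ℝ≥0∞} (hum : Measurable u) {K : Set X}
    (hK : IsCompact K) (hu : ∀ z : X × M, z.1 ∉ K → u z = 1) {Λ : Set X} (hΛ : IsOpen Λ)
    (hΛc : IsCompact (closure Λ)) (hKΛ : K ⊆ Λ) :
    ∫⁻ ξ, prodOver u ξ ∂P = ∫⁻ ξ, prodOver u ξ ∂(localPoisson τ Λ) := by
  rw [← h.map_restrict Λ hΛ hΛc, lintegral_map (measurable_prodOver hum hK hu)
    (measurable_restrict hΛ.measurableSet)]
  exact lintegral_congr fun ξ => (prodOver_restrict (fun z hz => hu z fun h => hz (hKΛ h)) ξ).symm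

variable [LocallyCompactSpace X]

theorem IsMarkedPoisson.hasPoissonVoids {τ : Measure (X × M)} {P : Measure (MarkedConfig X M)}
    (h : IsMarkedPoisson τ P) (hfin : ∀ Λ : Set X, MeasurableSet Λ → IsCompact (closure Λ) →
      τ (Λ ×ˢ univ) ≠ ⊤) (hτ : ∀ x : X, τ ({x} ×ˢ univ) = 0) : HasPoissonVoids τ P := by
  intro B hB
  obtain ⟨hBm, K, hK, hBK⟩ := id hB
  obtain ⟨Λ, hΛ, hKΛ, hΛc⟩ := exists_isOpen_superset_and_isCompact_closure hK
  have hBΛ : B ∩ Λ ×ˢ univ = B :=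
    inter_eq_left.2 (hBK.trans (prod_mono hKΛ Subset.rfl))
  have h1 := localPoisson_void (hfin Λ hΛ.measurableSet hΛc) hτ hB
  rw [← h.map_restrict Λ hΛ hΛc, Measure.map_apply (measurable_restrict hΛ.measurableSet)
    (measurableSet_void hB)] at h1
  simp_rw [preimage_ofPred_eq, count_restrict, hBΛ] at h1
  exact h1

/-- An infinite product of local Poisson measures on disjoint layers is pushed forward by `glue`. A
set with relatively compact projection meets finitely many layers, so its void event is a
finite-dimensional box and its probability a finite product. -/
theorem exists_hasPoissonVoids {τ : Measure (X × M)}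
    (hfin : ∀ Λ : Set X, MeasurableSet Λ → IsCompact (closure Λ) →
      τ (Λ ×ˢ univ) ≠ ⊤) (hτ : ∀ x : X, τ ({x} ×ˢ univ) = 0) :
    ∃ P : Measure (MarkedConfig X M), HasPoissonVoids τ P := by
  let K : CompactExhaustion X := default
  have hKm : ∀ n, MeasurableSet (disjointed K n) := fun n =>
    MeasurableSet.disjointed (fun n => (K.isCompact n).measurableSet) n
  have hKfin : ∀ n, τ (disjointed K n ×ˢ univ) ≠ ⊤ := fun n => by
    refine hfin _ (hKm n) ((K.isCompact n).of_isClosed_subset isClosed_closure ?_)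
    exact (K.isCompact n).isClosed.closure_subset_iff.2 (disjointed_subset _ n)
  let Q : ℕ → Measure (MarkedConfig X M) := fun n => localPoisson τ (disjointed K n)
  have hQ : ∀ n, IsProbabilityMeasure (Q n) := fun n => ⟨by
    have := localPoisson_void (hKfin n) hτ (B := ∅)
      ⟨.empty, ∅, isCompact_empty, empty_subset _⟩
    simpa [count] using this⟩
  have hsub : ∀ {B : Set (X × M)}, B ∈ relCompactSets X M → ∀ n,
      B ∩ disjointed K n ×ˢ univ ∈ relCompactSets X M := fun hB n =>
    ⟨hB.1.inter ((hKm n).prod .univ), hB.2.imp fun L hL => ⟨hL.1, inter_subset_left.trans hL.2⟩⟩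
  have hset : ∀ B ∈ relCompactSets X M, ∃ N : ℕ, B ⊆ K N ×ˢ univ ∧
      {ξ : ℕ → MarkedConfig X M | count B (glue K ξ) = 0} =
      Set.pi (Finset.range (N + 1)) fun n => {ξ | count (B ∩ disjointed K n ×ˢ univ) ξ = 0} := by
    rintro B ⟨-, L, hL, hBL⟩
    obtain ⟨N, hN⟩ := K.exists_superset_of_isCompact hL
    have hBN := hBL.trans (prod_mono hN Subset.rfl)
    refine ⟨N, hBN, ?_⟩
    ext ξ
    exact count_glue_eq_zero_iff K hBN ξ
  have hglue : Measurable (glue (M := M) K) := by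
    refine measurable_of_void fun B hB => ?_
    obtain ⟨N, -, hN⟩ := hset B hB
    rw [hN]
    exact MeasurableSet.pi (Finset.countable_toSet _) fun n _ => measurableSet_void (hsub hB n)
  refine ⟨(Measure.infinitePi Q).map (glue K), fun B hB => ?_⟩
  obtain ⟨N, hBN, hN⟩ := hset B hB
  rw [Measure.map_apply hglue (measurableSet_void hB), preimage_ofPred_eq, hN,
    Measure.infinitePi_pi _ fun n _ => measurableSet_void (hsub hB n)]
  have hcov : B = ⋃ n ∈ Finset.range (N + 1), B ∩ disjointed K n ×ˢ univ := by
    ext z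
    simp only [mem_iUnion, mem_inter_iff, mem_prod, mem_univ, and_true, exists_prop]
    refine ⟨fun hz => ?_, fun ⟨_, _, h, _⟩ => h⟩
    have hzU : z.1 ∈ ⋃ n, disjointed K n := by
      rw [iUnion_disjointed, K.iUnion_eq]; trivial
    obtain ⟨n, hn⟩ := mem_iUnion.1 hzU
    exact ⟨n, Finset.mem_range_succ_iff.2 (le_of_mem_disjointed K hn (hBN hz).1), hz, hn⟩
  have hτB : τ B = ∑ n ∈ Finset.range (N + 1), τ (B ∩ disjointed K n ×ˢ univ) := by
    conv_lhs => rw [hcov]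
    refine measure_biUnion_finset ?_ fun n _ => (hsub hB n).1
    intro n _ m _ hnm
    exact (disjoint_disjointed K hnm).set_prod_left univ univ |>.mono inter_subset_right
      inter_subset_right
  have hne : ∀ n, τ (B ∩ disjointed K n ×ˢ univ) ≠ ⊤ := fun n =>
    ne_top_of_le_ne_top (hKfin n) (measure_mono inter_subset_right)
  rw [hτB, ENNReal.toReal_sum fun n _ => hne n, ← Finset.sum_neg_distrib, Real.exp_sum,
    ENNReal.ofReal_prod_of_nonneg fun n _ => (Real.exp_pos _).le]
  refine Finset.prod_congr rfl fun n _ => ?_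
  rw [localPoisson_void (hKfin n) hτ (hsub hB n), inter_assoc, inter_self]

/-- Both measures are compared on void events. The left side is the void probability of `T ⁻¹' B`;
the right side is the integral of the product of `Bᶜ.indicator u`, computed in a window `Λ`
containing `K` and the positions of `B`. The window satisfies `T ⁻¹' (Λ × M) = Λ × M`, so the
exponents agree. -/
theorem IsMarkedPoisson.map_eq_withDensity {τ : Measure (X × M)} {P : Measure (MarkedConfig X M)}
    (h : IsMarkedPoisson τ P) (hfin : ∀ Λ : Set X, MeasurableSet Λ → IsCompact (closure Λ) →
      τ (Λ ×ˢ univ) ≠ ⊤) (hτ : ∀ x : X, τ ({x} ×ˢ univ) = 0)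
    {T : X × M → X × M} (hT : Measurable T) {F : MarkedConfig X M → MarkedConfig X M}
    (hTF : ∀ B ξ, count B (F ξ) = 0 ↔ count (T ⁻¹' B) ξ = 0)
    (hTB : ∀ B ∈ relCompactSets X M, T ⁻¹' B ∈ relCompactSets X M)
    {K : Set X} (hK : IsCompact K)
    (hTK : ∀ L : Set X, K ⊆ L → T ⁻¹' (L ×ˢ univ) = L ×ˢ univ)
    {u : X × M → ℝ≥0∞} (hum : Measurable u) (hu : ∀ z : X × M, z.1 ∉ K → u z = 1)
    (hmap : τ.map T = τ.withDensity u) :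
    Measurable F ∧ P.map F = P.withDensity (prodOver u) := by
  have hF : Measurable F := measurable_of_void fun B hB => by
    simp_rw [hTF]
    exact measurableSet_void (hTB B hB)
  have := h.isProbabilityMeasure
  have : IsProbabilityMeasure (P.map F) := Measure.isProbabilityMeasure_map hF.aemeasurable
  refine ⟨hF, ext_of_void fun B hB => ?_⟩
  have hvoid := measurableSet_void hB
  obtain ⟨hBm, L, hL, hBL⟩ := id hB
  have hKL := hK.union hL
  have hu' : ∀ z : X × M, z.1 ∉ K ∪ L → u z = 1 := fun z hz => hu z fun h => hz (Or.inl h)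
  have hBKL : B ⊆ (K ∪ L) ×ˢ univ := hBL.trans (prod_mono subset_union_right Subset.rfl)
  have hu'' : ∀ z : X × M, z.1 ∉ K ∪ L → Bᶜ.indicator u z = 1 := fun z hz => by
    rw [indicator_of_mem (show z ∈ Bᶜ from fun h => hz (hBKL h).1), hu' z hz]
  obtain ⟨Λ, hΛ, hKΛ, hΛc⟩ := exists_isOpen_superset_and_isCompact_closure hKL
  have hfinΛ := hfin Λ hΛ.measurableSet hΛc
  have hBΛ : B ⊆ Λ ×ˢ univ := hBKL.trans (prod_mono hKΛ Subset.rfl)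
  have hTΛ := hTK Λ (subset_union_left.trans hKΛ)
  -- Here `u` enters as the density of the image measure: integrating it over a set gives the
  -- `τ`-mass of the preimage.
  have hI : ∫⁻ z in Λ ×ˢ univ, Bᶜ.indicator u z ∂τ = τ (Λ ×ˢ univ \ T ⁻¹' B) := by
    rw [lintegral_indicator hBm.compl, Measure.restrict_restrict hBm.compl,
      ← withDensity_apply _ (hBm.compl.inter (hΛ.measurableSet.prod .univ)), ← hmap,
      Measure.map_apply hT (hBm.compl.inter (hΛ.measurableSet.prod .univ)), preimage_inter, hTΛ,
      preimage_compl, inter_comm, Set.sdiff_eq]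
  have hle : τ (Λ ×ˢ univ \ T ⁻¹' B) ≠ ⊤ := ne_top_of_le_ne_top hfinΛ (measure_mono sdiff_subset)
  rw [Measure.map_apply hF hvoid, preimage_ofPred_eq, withDensity_apply _ hvoid,
    ← lintegral_indicator hvoid, ← prodOver_compl_indicator hKL hu' hBKL,
    h.lintegral_prodOver (hum.indicator hBm.compl) hKL hu'' hΛ hΛc hKΛ,
    lintegral_localPoisson hfinΛ hτ (hum.indicator hBm.compl) hKL hu'' (hI ▸ hle), hI]
  simp_rw [hTF]
  rw [h.hasPoissonVoids hfin hτ _ (hTB B hB)]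
  congr 2
  have h3 := measure_inter_add_sdiff (μ := τ) (Λ ×ˢ univ) (hT hBm)
  have hTBΛ : T ⁻¹' B ⊆ Λ ×ˢ univ := hTΛ ▸ preimage_mono hBΛ
  rw [← h3, ENNReal.toReal_add (ne_top_of_le_ne_top hfinΛ (measure_mono inter_subset_left)) hle,
    inter_eq_right.2 hTBΛ]
  ring

end Poisson

/-- A zero-dimensional manifold is discrete; a connected discrete space is a point, hence compact.
-/
theorem dim_ne_zero {d : ℕ} (X : Type*) [TopologicalSpace X] [ConnectedSpace X] [NoncompactSpace X]
    [ChartedSpace (EuclideanSpace ℝ (Fin d)) X] : d ≠ 0 := by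
  rintro rfl
  have : DiscreteTopology X := by
    refine discreteTopology_iff_isOpen_singleton.2 fun x => ?_
    set e := chartAt (EuclideanSpace ℝ (Fin 0)) x
    have : e.source = {x} := by
      ext y
      refine ⟨fun hy => e.injOn hy (mem_chart_source _ x) (Subsingleton.elim _ _), ?_⟩
      rintro rfl
      exact mem_chart_source _ _
    exact this ▸ e.open_source
  have : Subsingleton X := PreconnectedSpace.trivial_of_discrete
  exact not_compactSpace_iff.2 ‹NoncompactSpace X› inferInstance

/-! ### The quasiinvariant measure on the mark space -/

section MarkMeasure

variable {G M : Type*} [Group G] [MulAction G M] [MeasurableSpace M] {lam : Measure M}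

theorem map_smul_eq_withDensity [SigmaFinite lam] (hqi : QuasiInvariant G lam) {plam : G → M → ℝ≥0}
    (hdens : ∀ h : G, (lam.map (fun m => h • m)).rnDeriv lam =ᵐ[lam]
      fun m => (plam h m : ℝ≥0∞)) (h : G) :
    lam.map (fun m => h • m) = lam.withDensity fun m => (plam h m : ℝ≥0∞) := by
  have : (lam.map (fun m => h • m)).HaveLebesgueDecomposition lam :=
    Measure.haveLebesgueDecomposition_of_sigmaFinite _ _
  rw [← withDensity_congr_ae (hdens h), Measure.withDensity_rnDeriv_eq _ _ (hqi h).2.1]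

variable [TopologicalSpace M]

/-- By transitivity the translates of a nonempty open null set cover `M`. They are null by
quasiinvariance, and second countability would then force `lam = 0`. -/
theorem isOpenPosMeasure_of_quasiInvariant [BorelSpace M]
    [SecondCountableTopology M] [MulAction.IsPretransitive G M]
    [ContinuousConstSMul G M] (hlam : lam ≠ 0) (hqi : QuasiInvariant G lam) :
    lam.IsOpenPosMeasure := by
  refine ⟨fun U hU ⟨u, hu⟩ h0 => hlam (Measure.measure_univ_eq_zero.1 ?_)⟩
  refine measure_null_of_locally_null univ fun m _ => ?_
  obtain ⟨h, hh⟩ := MulAction.exists_smul_eq G m u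
  refine ⟨(fun m => h • m) ⁻¹' U, mem_nhdsWithin_of_mem_nhds
    ((hU.preimage (continuous_const_smul h)).mem_nhds (by simpa [hh] using hu)), ?_⟩
  rw [← Measure.map_apply (hqi h).1 hU.measurableSet]
  exact (hqi h).2.1 h0

theorem density_one_eq_one [SigmaFinite lam] [lam.IsOpenPosMeasure] {plam : G → M → ℝ≥0}
    (hcont : Continuous fun m => (plam 1 m : ℝ))
    (hdens : (lam.map (fun m => (1 : G) • m)).rnDeriv lam =ᵐ[lam]
      fun m => (plam 1 m : ℝ≥0∞)) (m : M) : plam 1 m = 1 := by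
  have h1 : (fun m => (plam 1 m : ℝ)) =ᵐ[lam] fun _ => 1 := by
    simp only [one_smul, Measure.map_id'] at hdens
    filter_upwards [hdens, Measure.rnDeriv_self lam] with m hm hm'
    rw [hm] at hm'
    exact_mod_cast hm'
  have h2 := (hcont.ae_eq_iff_eq lam continuous_const).1 h1
  exact_mod_cast congrFun h2 m

end MarkMeasure

/-! ### The transformation group acting on the Lévy measure -/

section Transformations

variable {d k l : ℕ} {X G M : Type*}
  [TopologicalSpace X] [ChartedSpace (EuclideanSpace ℝ (Fin d)) X]
  [TopologicalSpace G] [ChartedSpace (EuclideanSpace ℝ (Fin k)) G] [Group G]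

theorem Transf.exists_support (a : Transf d k X G) : ∃ K : Set X, IsCompact K ∧
    ∀ x ∉ K, a.ψ x = x ∧ a.ψ.symm x = x ∧ a.η x = 1 := by
  obtain ⟨K, hK, h⟩ := a.ψ_supp
  obtain ⟨L, hL, h'⟩ := a.symm_supp
  obtain ⟨N, hN, h''⟩ := a.η_supp
  refine ⟨K ∪ L ∪ N, (hK.union hL).union hN, fun x hx => ?_⟩
  simp only [mem_union, not_or] at hx
  exact ⟨h x hx.1.1, h' x hx.1.2, h'' x hx.2⟩

theorem measurable_density_comp [TopologicalSpace M] [SecondCountableTopology M] [MeasurableSpace X]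
    [BorelSpace X] [MeasurableSpace M] [BorelSpace M] {plam : G → M → ℝ≥0}
    (hcont : Continuous fun z : G × M => (plam z.1 z.2 : ℝ))
    (a : Transf d k X G) : Measurable fun z : X × M => (plam (a.η z.1) z.2 : ℝ≥0∞) := by
  have h2 : Continuous a.η := a.η.contMDiff.continuous
  have h : Continuous fun z : X × M => ENNReal.ofReal (plam (a.η z.1) z.2) :=
    ENNReal.continuous_ofReal.comp (hcont.comp (by fun_prop : Continuous fun z : X × M =>
      (a.η z.1, z.2)))
  simpa only [ENNReal.ofReal_coe_nnreal] using h.measurable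

variable [LieGroup (𝓡 k) ∞ G] [MulAction G M]

theorem Transf.inv_smul_def (a : Transf d k X G) (z : X × M) :
    a⁻¹ • z = (a.ψ.symm z.1, (a.η z.1)⁻¹ • z.2) := by
  rw [Transf.smul_def, Transf.inv_η]
  change (a.ψ.symm z.1, (a.η (a.ψ (a.ψ.symm z.1)))⁻¹ • z.2) = _
  rw [a.ψ.apply_symm_apply]

theorem onePointDensity_eq [IsManifold (𝓡 d) ∞ X] (g : RiemMetric d X) (plam : G → M → ℝ≥0)
    (ρ : X → ℝ≥0∞) (p : X → M → ℝ≥0∞)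
    (a : Transf d k X G) (z : X × M) :
    onePointDensity g plam ρ p a z =
      open Classical in
      if (0 < ρ z.1 * p z.1 z.2 ∧ ρ z.1 * p z.1 z.2 < ⊤) ∧
          (0 < ρ (a⁻¹ • z).1 * p (a⁻¹ • z).1 (a⁻¹ • z).2 ∧
            ρ (a⁻¹ • z).1 * p (a⁻¹ • z).1 (a⁻¹ • z).2 < ⊤) then
        ρ (a⁻¹ • z).1 * p (a⁻¹ • z).1 (a⁻¹ • z).2 / (ρ z.1 * p z.1 z.2) *
          plam (a.η z.1) z.2 * jacobian g a.ψ z.1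
      else 1 := by
  rw [a.inv_smul_def]
  rfl

/-- Off `K` both `ψ⁻¹` and the action on marks are trivial. The complement of `K` is open, so `ψ⁻¹`
is the identity near the point and its Jacobian is `1` too. -/
theorem onePointDensity_eq_one [T2Space X] [IsManifold (𝓡 d) ∞ X] (g : RiemMetric d X)
    {plam : G → M → ℝ≥0} {ρ : X → ℝ≥0∞} {p : X → M → ℝ≥0∞} (hone : ∀ m, plam 1 m = 1) (a : Transf d k X G)
    {K : Set X} (hK : IsCompact K)
    (hKa : ∀ x ∉ K, a.ψ x = x ∧ a.ψ.symm x = x ∧ a.η x = 1) {z : X × M} (hz : z.1 ∉ K) :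
    onePointDensity g plam ρ p a z = 1 := by
  have hJ : jacobian g a.ψ z.1 = 1 := by
    refine jacobian_eq_one g a.ψ ?_
    filter_upwards [hK.isClosed.isOpen_compl.mem_nhds hz] with x hx
    exact (hKa x hx).2.1
  have hinv : a⁻¹ • z = z := by
    rw [a.inv_smul_def, (hKa _ hz).2.1, (hKa _ hz).2.2, inv_one, one_smul]
  rw [onePointDensity_eq, hinv, (hKa _ hz).2.2, hone, hJ]
  split_ifs with h
  · rw [ENNReal.div_self h.1.1.ne' h.1.2.ne]
    simp
  · rfl

theorem Transf.count_smul (a : Transf d k X G) (B : Set (X × M)) (ξ : MarkedConfig X M) :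
    count B (a • ξ) = count ((fun z => a • z) ⁻¹' B) ξ := by
  change ((fun z => a • z) '' ξ.1 ∩ B).ncard = _
  rw [← image_inter_preimage, ncard_image_of_injective _ (MulAction.injective a), count]

theorem Transf.preimage_prod_univ (a : Transf d k X G) {K L : Set X}
    (hK : ∀ x ∉ K, a.ψ x = x ∧ a.ψ.symm x = x ∧ a.η x = 1) (hKL : K ⊆ L) :
    (fun z : X × M => a • z) ⁻¹' (L ×ˢ univ) = L ×ˢ univ := by
  ext z
  simp only [mem_preimage, mem_prod, mem_univ, and_true, Transf.smul_def]
  constructor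
  · intro h
    by_contra hz
    rw [(hK z.1 fun h' => hz (hKL h')).1] at h
    exact hz h
  · intro h
    by_contra hz
    have := (hK _ fun h' => hz (hKL h')).2.1
    rw [a.ψ.symm_apply_apply] at this
    exact hz (this ▸ h)

variable [TopologicalSpace M] [ContinuousSMul G M]

theorem Transf.continuous_smul (a : Transf d k X G) : Continuous fun z : X × M => a • z := by
  have h1 : Continuous a.ψ := a.ψ.continuous
  have h2 : Continuous a.η := a.η.contMDiff.continuous
  change Continuous fun z : X × M => (a.ψ z.1, a.η (a.ψ z.1) • z.2)
  fun_prop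

variable [MeasurableSpace X] [BorelSpace X] [MeasurableSpace M] [BorelSpace M]
  [SecondCountableTopology M]

theorem Transf.measurable_smul (a : Transf d k X G) :
    Measurable fun z : X × M => a • z := a.continuous_smul.measurable

theorem Transf.preimage_mem_relCompactSets (a : Transf d k X G)
    {B : Set (X × M)} (hB : B ∈ relCompactSets X M) :
    (fun z => a • z) ⁻¹' B ∈ relCompactSets X M := by
  obtain ⟨hBm, K, hK, hBK⟩ := hB
  refine ⟨a.measurable_smul hBm, a.ψ.symm '' K, hK.image a.ψ.symm.continuous, fun z hz => ?_⟩
  exact ⟨⟨a.ψ z.1, (hBK hz).1, a.ψ.symm_apply_apply z.1⟩, trivial⟩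

variable [IsManifold (𝓡 d) ∞ X] (g : RiemMetric d X) {plam : G → M → ℝ≥0} {ρ : X → ℝ≥0∞}
  {p : X → M → ℝ≥0∞}

theorem measurable_onePointDensity
    (hcont : Continuous fun z : G × M => (plam z.1 z.2 : ℝ))
    (hρ : Measurable ρ) (hp : Measurable (Function.uncurry p)) (a : Transf d k X G) :
    Measurable (onePointDensity g plam ρ p a) := by
  have hq : Measurable fun z : X × M => ρ z.1 * p z.1 z.2 := (hρ.comp measurable_fst).mul hp
  have hq' := hq.comp (a⁻¹).measurable_smul
  have hJ : Measurable (jacobian g a.ψ) := (continuous_jacobian g a.ψ).measurable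
  rw [funext (onePointDensity_eq g plam ρ p a)]
  refine Measurable.ite ?_ (((hq'.div hq).mul (measurable_density_comp hcont a)).mul
    (hJ.comp measurable_fst)) measurable_const
  exact ((measurableSet_lt measurable_const hq).inter (measurableSet_lt hq measurable_const)).inter
    ((measurableSet_lt measurable_const hq').inter (measurableSet_lt hq' measurable_const))

variable [SecondCountableTopology X] {lam : Measure M} [SigmaFinite lam]

/-- On the fibre over `x` the group acts by the single element `η (ψ x)`, so the mark density
applies fibrewise. What remains depends on `x` only through `ψ x`, and `map_riemVolume` finishes. -/
theorem map_smul_prod (hqi : QuasiInvariant G lam)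
    (hcont : Continuous fun z : G × M => (plam z.1 z.2 : ℝ))
    (hdens : ∀ h : G, (lam.map (fun m => h • m)).rnDeriv lam =ᵐ[lam]
      fun m => (plam h m : ℝ≥0∞)) (a : Transf d k X G) :
    ((riemVolume g).prod lam).map (fun z => a • z) = ((riemVolume g).prod lam).withDensity
      fun z => plam (a.η z.1) z.2 * jacobian g a.ψ z.1 := by
  have hJ : Measurable (jacobian g a.ψ) := (continuous_jacobian g a.ψ).measurable
  have hp := measurable_density_comp hcont a
  have hD : Measurable fun z : X × M => (plam (a.η z.1) z.2 : ℝ≥0∞) * jacobian g a.ψ z.1 :=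
    hp.mul (hJ.comp measurable_fst)
  ext S hS
  rw [Measure.map_apply a.measurable_smul hS, Measure.prod_apply (a.measurable_smul hS),
    withDensity_apply _ hS, ← lintegral_indicator hS, lintegral_prod _
      (hD.indicator hS).aemeasurable]
  have h1 : ∀ x, lam (Prod.mk x ⁻¹' ((fun z : X × M => a • z) ⁻¹' S)) =
      (fun x => ∫⁻ m, S.indicator (fun z => (plam (a.η z.1) z.2 : ℝ≥0∞)) (x, m) ∂lam) (a.ψ x) := by
    intro x
    have hSx : MeasurableSet (Prod.mk (a.ψ x) ⁻¹' S) := measurable_prodMk_left hS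
    have h2 : Prod.mk x ⁻¹' ((fun z : X × M => a • z) ⁻¹' S) =
        (fun m => a.η (a.ψ x) • m) ⁻¹' (Prod.mk (a.ψ x) ⁻¹' S) := rfl
    rw [h2, ← Measure.map_apply (hqi _).1 hSx, map_smul_eq_withDensity hqi hdens,
      withDensity_apply _ hSx, ← lintegral_indicator hSx]
    rfl
  have hmeas : Measurable fun x =>
      ∫⁻ m, S.indicator (fun z => (plam (a.η z.1) z.2 : ℝ≥0∞)) (x, m) ∂lam :=
    (hp.indicator hS).lintegral_prod_right'
  rw [lintegral_congr h1, ← lintegral_map hmeas a.ψ.continuous.measurable, map_riemVolume,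
    lintegral_withDensity_eq_lintegral_mul _ hJ hmeas]
  refine lintegral_congr fun x => ?_
  have hx : Measurable fun m => S.indicator (fun z => (plam (a.η z.1) z.2 : ℝ≥0∞)) (x, m) :=
    (hp.indicator hS).comp measurable_prodMk_left
  rw [Pi.mul_apply, ← lintegral_const_mul _ hx]
  refine lintegral_congr fun m => ?_
  by_cases h : (x, m) ∈ S
  · simp only [indicator_of_mem h, mul_comm]
  · simp only [indicator_of_notMem h, mul_zero]

theorem map_smul_levyMeasure (hqi : QuasiInvariant G lam)
    (hcont : Continuous fun z : G × M => (plam z.1 z.2 : ℝ))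
    (hdens : ∀ h : G, (lam.map (fun m => h • m)).rnDeriv lam =ᵐ[lam]
      fun m => (plam h m : ℝ≥0∞))
    (hρ : Measurable ρ) (hp : Measurable (Function.uncurry p))
    (hq : ∀ᵐ z ∂((riemVolume g).prod lam), 0 < ρ z.1 * p z.1 z.2 ∧ ρ z.1 * p z.1 z.2 < ⊤)
    (a : Transf d k X G) :
    (levyMeasure g lam ρ p).map (fun z => a • z) =
      (levyMeasure g lam ρ p).withDensity (onePointDensity g plam ρ p a) := by
  have hqm : Measurable fun z : X × M => ρ z.1 * p z.1 z.2 := (hρ.comp measurable_fst).mul hp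
  have hqm' : Measurable fun z : X × M => ρ (a⁻¹ • z).1 * p (a⁻¹ • z).1 (a⁻¹ • z).2 :=
    hqm.comp (a⁻¹).measurable_smul
  have hJ : Measurable (jacobian g a.ψ) := (continuous_jacobian g a.ψ).measurable
  have hD : Measurable fun z : X × M => (plam (a.η z.1) z.2 : ℝ≥0∞) * jacobian g a.ψ z.1 :=
    (measurable_density_comp hcont a).mul (hJ.comp measurable_fst)
  -- Transporting `hq` by `a⁻¹` makes the exceptional branch of `onePointDensity` negligible.
  have hq' : ∀ᵐ z ∂((riemVolume g).prod lam),
      0 < ρ (a⁻¹ • z).1 * p (a⁻¹ • z).1 (a⁻¹ • z).2 ∧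
        ρ (a⁻¹ • z).1 * p (a⁻¹ • z).1 (a⁻¹ • z).2 < ⊤ := by
    have hac : ((riemVolume g).prod lam).map (fun z => a⁻¹ • z) ≪ (riemVolume g).prod lam := by
      rw [map_smul_prod g hqi hcont hdens]
      exact withDensity_absolutelyContinuous _ _
    exact ae_of_ae_map (a⁻¹).measurable_smul.aemeasurable (hac.ae_le hq)
  ext S hS
  -- Writing `q` as `(q ∘ a⁻¹) ∘ a` lets the integral be pushed forward along `a`, which produces
  -- the numerator of the one-point density.
  have h1 : ∀ z : X × M, (ρ z.1 * p z.1 z.2) =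
      (fun z => ρ (a⁻¹ • z).1 * p (a⁻¹ • z).1 (a⁻¹ • z).2) (a • z) := fun z => by
    simp only [inv_smul_smul]
  rw [Measure.map_apply a.measurable_smul hS, withDensity_apply _ hS, levyMeasure,
    withDensity_apply _ (a.measurable_smul hS), restrict_withDensity hS,
    lintegral_withDensity_eq_lintegral_mul _ hqm (measurable_onePointDensity g hcont hρ hp a),
    lintegral_congr h1, ← setLIntegral_map hS hqm' a.measurable_smul,
    map_smul_prod g hqi hcont hdens, restrict_withDensity hS,
    lintegral_withDensity_eq_lintegral_mul _ hD hqm']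
  refine lintegral_congr_ae (ae_restrict_of_ae ?_)
  filter_upwards [hq, hq'] with z hz hz'
  rw [Pi.mul_apply, Pi.mul_apply, onePointDensity_eq, if_pos ⟨hz, hz'⟩,
    mul_assoc (_ / _), ← mul_assoc (ρ z.1 * p z.1 z.2), ENNReal.mul_div_cancel hz.1.ne' hz.2.ne,
    mul_comm]

end Transformations

/-! ### Null fibres and nondegeneracy of the Lévy density -/

section LevyMeasure

variable {d : ℕ} {X M : Type*} [TopologicalSpace X] [ChartedSpace (EuclideanSpace ℝ (Fin d)) X]
  [IsManifold (𝓡 d) ∞ X] [MeasurableSpace X] [BorelSpace X]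
  [MeasurableSpace M] (g : RiemMetric d X) {lam : Measure M} [SFinite lam]
  {ρ : X → ℝ≥0∞} {p : X → M → ℝ≥0∞}

theorem levyMeasure_singleton_prod [T1Space X] (hd : d ≠ 0) (x : X) :
    levyMeasure g lam ρ p ({x} ×ˢ univ) = 0 := by
  refine withDensity_absolutelyContinuous _ _ ?_
  rw [Measure.prod_prod, riemVolume_singleton g hd, zero_mul]

/-- Finiteness comes from the finite integral of `q` over `K n × M` for a compact exhaustion `K`,
positivity from Fubini. -/
theorem ae_levyDensity_pos_lt_top [SecondCountableTopology X] [T2Space X] [LocallyCompactSpace X]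
    (hρ : Measurable ρ)
    (hp : Measurable (Function.uncurry p))
    (hρpos : ∀ᵐ x ∂(riemVolume g), 0 < ρ x)
    (hppos : ∀ᵐ x ∂(riemVolume g), ∀ᵐ m ∂lam, 0 < p x m)
    (hfin : ∀ Λ : Set X, MeasurableSet Λ → IsCompact (closure Λ) →
      levyMeasure g lam ρ p (Λ ×ˢ univ) < ⊤) :
    ∀ᵐ z ∂((riemVolume g).prod lam), 0 < ρ z.1 * p z.1 z.2 ∧ ρ z.1 * p z.1 z.2 < ⊤ := by
  have hq : Measurable fun z : X × M => ρ z.1 * p z.1 z.2 := (hρ.comp measurable_fst).mul hp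
  have hpos : ∀ᵐ z ∂((riemVolume g).prod lam), 0 < ρ z.1 * p z.1 z.2 := by
    rw [Measure.ae_prod_iff_ae_ae (measurableSet_lt measurable_const hq)]
    filter_upwards [hρpos, hppos] with x hx hx'
    filter_upwards [hx'] with m hm
    exact ENNReal.mul_pos hx.ne' hm.ne'
  have hlt : ∀ᵐ z ∂((riemVolume g).prod lam), ρ z.1 * p z.1 z.2 < ⊤ := by
    let K : CompactExhaustion X := default
    have hK : ∀ n, ∀ᵐ z ∂((riemVolume g).prod lam), z ∈ K n ×ˢ univ →
        ρ z.1 * p z.1 z.2 < ⊤ := fun n => by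
      have hm : MeasurableSet (K n ×ˢ (univ : Set M)) := (K.isCompact n).measurableSet.prod .univ
      have h := hfin (K n) (K.isCompact n).measurableSet (by
        rw [(K.isCompact n).isClosed.closure_eq]; exact K.isCompact n)
      rw [levyMeasure, withDensity_apply _ hm] at h
      exact (ae_restrict_iff' hm).1 (ae_lt_top hq h.ne)
    filter_upwards [ae_all_iff.2 hK] with z hz
    obtain ⟨n, hn⟩ := K.exists_mem z.1
    exact hz n ⟨hn, trivial⟩
  filter_upwards [hpos, hlt] with z h h' using ⟨h, h'⟩

end LevyMeasure

end MarkedPoisson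

end

/-! ### The main theorem -/

theorem proposition2p3
    {d k l : ℕ} {X G M : Type*}
    -- the position space: a connected non-compact Riemannian manifold
    [TopologicalSpace X] [T2Space X] [SecondCountableTopology X] [ConnectedSpace X]
    [NoncompactSpace X]
    [ChartedSpace (EuclideanSpace ℝ (Fin d)) X] [IsManifold (𝓡 d) ∞ X]
    [MeasurableSpace X] [BorelSpace X]
    (g : MarkedPoisson.RiemMetric d X)
    -- the Lie group
    [TopologicalSpace G] [T2Space G] [SecondCountableTopology G]
    [ChartedSpace (EuclideanSpace ℝ (Fin k)) G] [Group G] [LieGroup (𝓡 k) ∞ G]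
    -- the mark space: a homogeneous space of the Lie group
    [TopologicalSpace M] [T2Space M] [SecondCountableTopology M] [ConnectedSpace M]
    [ChartedSpace (EuclideanSpace ℝ (Fin l)) M] [IsManifold (𝓡 l) ∞ M]
    [MeasurableSpace M] [BorelSpace M]
    [MulAction G M] [MulAction.IsPretransitive G M] [ContMDiffSMul (𝓡 k) (𝓡 l) ∞ G M]
    -- a quasiinvariant measure on the mark space with differentiable densities
    (lam : Measure M) [IsFiniteMeasureOnCompacts lam] (hlam : lam ≠ 0)
    (hlamqi : MarkedPoisson.QuasiInvariant G lam)
    (plam : G → M → ℝ≥0)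
    (hplam : MDifferentiable ((𝓡 k).prod (𝓡 l)) 𝓘(ℝ, ℝ)
      (fun z : G × M => (plam z.1 z.2 : ℝ)))
    (hplamdens : ∀ h : G, (lam.map (fun m => h • m)).rnDeriv lam =ᵐ[lam]
      fun m => (plam h m : ℝ≥0∞))
    -- the densities of the intensity measure and of the mark distributions
    (ρ : X → ℝ≥0∞) (hρ : Measurable ρ)
    (hρpos : ∀ᵐ x ∂(MarkedPoisson.riemVolume g), 0 < ρ x)
    (hρloc : ∀ K : Set X, IsCompact K → ∫⁻ x in K, ρ x ∂(MarkedPoisson.riemVolume g) < ⊤)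
    (p : X → M → ℝ≥0∞) (hp : Measurable (Function.uncurry p))
    (hppos : ∀ᵐ x ∂(MarkedPoisson.riemVolume g), ∀ᵐ m ∂lam, 0 < p x m)
    (hfin : ∀ Λ : Set X, MeasurableSet Λ → IsCompact (closure Λ) →
      MarkedPoisson.levyMeasure g lam ρ p (Λ ×ˢ univ) < ⊤) :
    ∃ P : Measure (MarkedPoisson.MarkedConfig X M),
      -- the marked Poisson measure
      MarkedPoisson.IsMarkedPoisson (MarkedPoisson.levyMeasure g lam ρ p) P ∧
      (∀ P', MarkedPoisson.IsMarkedPoisson (MarkedPoisson.levyMeasure g lam ρ p) P' → P' = P) ∧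
      -- its quasiinvariance
      MarkedPoisson.QuasiInvariant (MarkedPoisson.Transf d k X G) P ∧
      ∀ a : MarkedPoisson.Transf d k X G,
        -- the one-point density is the density of the transformed Lévy measure
        (MarkedPoisson.levyMeasure g lam ρ p).map (fun z => a • z) =
          (MarkedPoisson.levyMeasure g lam ρ p).withDensity
            (MarkedPoisson.onePointDensity g plam ρ p a) ∧
        -- the product has finitely many factors different from one
        (∀ ξ : MarkedPoisson.MarkedConfig X M,
          {z ∈ ξ.1 | MarkedPoisson.onePointDensity g plam ρ p a z ≠ 1}.Finite) ∧
        -- the density of the transformed marked Poisson measure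
        (P.map (fun ξ => a • ξ)).rnDeriv P =ᵐ[P]
          fun ξ => ∏ᶠ z ∈ ξ.1, MarkedPoisson.onePointDensity g plam ρ p a z := by
  have : LocallyCompactSpace X := ChartedSpace.locallyCompactSpace (EuclideanSpace ℝ (Fin d)) X
  have : LocallyCompactSpace M := ChartedSpace.locallyCompactSpace (EuclideanSpace ℝ (Fin l)) M
  have : ContinuousSMul G M := ContMDiffSMul.continuousSMul (I := 𝓡 k) (I' := 𝓡 l) ∞
  have hcont : Continuous fun z : G × M => (plam z.1 z.2 : ℝ) := hplam.continuous
  have := MarkedPoisson.isOpenPosMeasure_of_quasiInvariant hlam hlamqi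
  have hone : ∀ m, plam 1 m = 1 := MarkedPoisson.density_one_eq_one
    (hcont.comp (Continuous.prodMk_right (1 : G))) (hplamdens 1)
  have hq := MarkedPoisson.ae_levyDensity_pos_lt_top g hρ hp hρpos hppos hfin
  have hfin' : ∀ Λ : Set X, MeasurableSet Λ → IsCompact (closure Λ) →
      MarkedPoisson.levyMeasure g lam ρ p (Λ ×ˢ univ) ≠ ⊤ := fun Λ h h' => (hfin Λ h h').ne
  have hτ : ∀ x : X, MarkedPoisson.levyMeasure g lam ρ p ({x} ×ˢ univ) = 0 :=
    MarkedPoisson.levyMeasure_singleton_prod g (MarkedPoisson.dim_ne_zero X)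
  obtain ⟨P, hP⟩ := MarkedPoisson.exists_hasPoissonVoids hfin' hτ
  have hPM := hP.isMarkedPoisson hfin' hτ
  have := hP.isProbabilityMeasure
  have hmap := fun a : MarkedPoisson.Transf d k X G =>
    MarkedPoisson.map_smul_levyMeasure g hlamqi hcont hplamdens hρ hp hq a
  have hum := fun a : MarkedPoisson.Transf d k X G =>
    MarkedPoisson.measurable_onePointDensity g hcont hρ hp a
  have hmain : ∀ a : MarkedPoisson.Transf d k X G,
      Measurable (fun ξ : MarkedPoisson.MarkedConfig X M => a • ξ) ∧
        P.map (fun ξ => a • ξ) = P.withDensity (MarkedPoisson.prodOver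
          (MarkedPoisson.onePointDensity g plam ρ p a)) := fun a => by
    obtain ⟨K, hK, hKa⟩ := a.exists_support
    exact hPM.map_eq_withDensity hfin' hτ a.measurable_smul
      (fun B ξ => by rw [a.count_smul]) (fun B hB => a.preimage_mem_relCompactSets hB) hK
      (fun L hL => a.preimage_prod_univ hKa hL) (hum a)
      (fun z hz => MarkedPoisson.onePointDensity_eq_one g hone a hK hKa hz) (hmap a)
  have hac : ∀ a : MarkedPoisson.Transf d k X G, P.map (fun ξ => a • ξ) ≪ P := fun a => by
    rw [(hmain a).2]
    exact withDensity_absolutelyContinuous _ _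
  refine ⟨P, hPM, fun P' hP' => ?_, fun a => ⟨(hmain a).1, hac a, ?_⟩,
    fun a => ⟨hmap a, fun ξ => ?_, ?_⟩⟩
  · have := hP'.isProbabilityMeasure
    refine MarkedPoisson.ext_of_void fun B hB => ?_
    rw [hP B hB, hP'.hasPoissonVoids hfin' hτ B hB]
  -- Pushing the absolute continuity for `a⁻¹` forward by `a` gives the reverse direction, so
  -- positivity of the density is not needed.
  · have h := (hac a⁻¹).map (hmain a).1
    rw [Measure.map_map (hmain a).1 (hmain a⁻¹).1] at h
    have hid : ((fun ξ : MarkedPoisson.MarkedConfig X M => a • ξ) ∘ fun ξ => a⁻¹ • ξ) = id := by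
      ext ξ
      simp
    rwa [hid, Measure.map_id] at h
  · obtain ⟨K, hK, hKa⟩ := a.exists_support
    refine (MarkedPoisson.finite_inter_of_subset ξ hK Subset.rfl).subset ?_
    rintro z ⟨hz, hz1⟩
    exact ⟨hz, by_contra fun h => hz1
      (MarkedPoisson.onePointDensity_eq_one g hone a hK hKa h), trivial⟩
  · obtain ⟨K, hK, hKa⟩ := a.exists_support
    rw [(hmain a).2]
    exact Measure.rnDeriv_withDensity P (MarkedPoisson.measurable_prodOver (hum a) hK
      fun z hz => MarkedPoisson.onePointDensity_eq_one g hone a hK hKa hz)
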